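/- **Lemma (Rushing Lemma).** All registers are finite-dimensional complex Hilbert spaces, $D(\mathcal H)$ denotes the density operators on $\mathcal H$, a *quantum operation* is a completely positive trace-preserving map, $M\cdot\rho:=M\rho M^\dagger$, and $\Delta(\rho,\sigma):=\tfrac12\|\rho-\sigma\|_1$. An *$n$-step two-party strategy with oracle calls* has input spaces $\mathcal A_0,\mathcal B_0$, memory spaces $\mathcal A_i=\mathcal A_i^{O}\otimes\mathcal A_i'$ and $\mathcal B_i=\mathcal B_i^{O}\otimes\mathcal B_i'$ $(1\le i\le n)$, quantum operations $\mathscr A_i:L(\mathcal A_{i-1})\to L(\mathcal A_i)$, $\mathscr B_i:L(\mathcal B_{i-1})\to L(\mathcal B_i)$ of the two parties, and oracles, i.e. quantum operations $\mathcal O_i$ on $L(\mathcal A_i^{O}\otimes\mathcal B_i^{O})$. Let $\mathcal R$ be a reference system with $\dim\mathcal R=\dim\mathcal A_0\dim\mathcal B_0$. For $\rho_{\rm in}\in D(\mathcal A_0\otimes\mathcal B_0\otimes\mathcal R)$ the joint states are $\rho_0(\rho_{\rm in})=\rho_{\rm in}$ and $$\rho_i(\rho_{\rm in})=(\mathbb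 1_{\mathcal A_i'\otimes\mathcal B_i'\otimes\mathcal R}\otimes\mathcal O_i)(\mathscr A_i\otimes\mathscr B_i\otimes\mathbb 1_{\mathcal R})(\rho_{i-1}(\rho_{\rm in})),$$ and $[\mathscr A\circledast\mathscr B](\rho_{\rm in}):=\rho_n(\rho_{\rm in})$. A *protocol* for a unitary $U$ on $\mathcal A_0\otimes\mathcal B_0$ is such a strategy with fixed identifications $\mathcal A_n\cong\mathcal A_0$, $\mathcal B_n\cong\mathcal B_0$; it is *$\varepsilon$-correct* if $\Delta([\mathscr A\circledast\mathscr B](\rho_{\rm in}),(U\otimes\mathbb 1_{\mathcal R})\cdot\rho_{\rm in})\le\varepsilon$ for all $\rho_{\rm in}\in D(\mathcal A_0\otimes\mathcal B_0\otimes\mathcal R)$. (An exactly correct protocol is $\varepsilon$-correct for every $\varepsilon\ge0$.) An adversary $\tilde{\mathscr A}$ replaces Alice's private memory and operations, keeping her input space ($\tilde{\mathcal A}_0=\mathcal A_0$) and her oracle registers: $\tilde{\mathcal A}_i=\mathcal A_i^{O}\otimes\tilde{\mathcal A}_i'$. Write $\tilde\rho_i(\rho_{\rm in})$ for the joint states of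 $\tilde{\mathscr A}$ with the honest $\mathscr B$. The adversary is *$\varepsilon$-specious* if there are quantum operations $\mathscr T_i:L(\tilde{\mathcal A}_i)\to L(\mathcal A_i)$, $1\le i\le n$, with $$\Delta\big((\mathscr T_i\otimes\mathbb 1_{\mathcal B_i\otimes\mathcal R})(\tilde\rho_i(\rho_{\rm in})),\,\rho_i(\rho_{\rm in})\big)\le\varepsilon\quad\text{for all }\rho_{\rm in}\in D(\mathcal A_0\otimes\mathcal B_0\otimes\mathcal R)\text{ and all }1\le i\le n.$$ Specious adversaries $\tilde{\mathscr B}$ in the role of Bob are defined symmetrically. Let a protocol for $U$ be $\varepsilon$-correct. Then for every $\varepsilon$-specious adversary $\tilde{\mathscr A}$ there are a finite-dimensional space $\widehat{\mathcal A}$, a linear isometry $T:\tilde{\mathcal A}_n\to\mathcal A_n\otimes\widehat{\mathcal A}$ and a state $\tilde\varrho\in D(\widehat{\mathcal A})$, independent of the input, such that for all $\rho_{\rm in}\in D(\mathcal A_0\otimes\mathcal B_0\otimes\mathcal R)$, $$\Delta\Big((T\otimes\mathbb 1_{\mathcal B_n\otimes\mathcal R})\cdot[\tilde{\mathscr A}\circledast\mathscr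 B](\rho_{\rm in}),\ \tilde\varrho\otimes\big((U\otimes\mathbb 1_{\mathcal R})\cdot\rho_{\rm in}\big)\Big)\le 12\sqrt{2\varepsilon}.$$ Likewise, for every $\varepsilon$-specious adversary $\tilde{\mathscr B}$ there are a finite-dimensional space $\widehat{\mathcal B}$, a linear isometry $T:\tilde{\mathcal B}_n\to\mathcal B_n\otimes\widehat{\mathcal B}$ and a state $\tilde\varrho\in D(\widehat{\mathcal B})$ such that for all such $\rho_{\rm in}$, $$\Delta\Big((T\otimes\mathbb 1_{\mathcal A_n\otimes\mathcal R})\cdot[\mathscr A\circledast\tilde{\mathscr B}](\rho_{\rm in}),\ \tilde\varrho\otimes\big((U\otimes\mathbb 1_{\mathcal R})\cdot\rho_{\rm in}\big)\Big)\le 12\sqrt{2\varepsilon}.$$ -/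

import Mathlib

open scoped Matrix Kronecker ComplexOrder

noncomputable section

namespace Specious

/-!
Registers are finite-dimensional Hilbert spaces `ℂ^a` with a fixed orthonormal basis indexed by a
finite type `a`; the tensor product of the registers `a` and `b` is indexed by `a × b`, and
operators on a register are the matrices `Matrix a a ℂ`.
-/

/-! ### States, isometries, trace distance -/

/-- Density operators: positive semidefinite with trace one. -/
structure IsDensity {a : Type*} [Fintype a] (ρ : Matrix a a ℂ) : Prop where
  posSemidef : ρ.PosSemidef
  trace_eq_one : ρ.trace = 1

/-- Linear isometries: `Tᴴ T = 1`. -/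
def IsIsometry {a b : Type*} [DecidableEq a] [Fintype b] (T : Matrix b a ℂ) : Prop :=
  Tᴴ * T = 1

/-- `M · ρ = M ρ Mᴴ`. -/
def conj {a b : Type*} [Fintype a] (M : Matrix b a ℂ) (ρ : Matrix a a ℂ) : Matrix b b ℂ :=
  M * ρ * Mᴴ

/-- The trace norm `‖X‖ = tr √(Xᴴ X)`, that is, the sum of the singular values of `X`. -/
def traceNorm {a : Type*} [Fintype a] [DecidableEq a] (X : Matrix a a ℂ) : ℝ :=
  ∑ i, √((Matrix.isHermitian_conjTranspose_mul_self X).eigenvalues i)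

/-- The trace distance `Δ(ρ, σ) = ½ ‖ρ - σ‖`. -/
def traceDist {a : Type*} [Fintype a] [DecidableEq a] (ρ σ : Matrix a a ℂ) : ℝ :=
  (1 / 2) * traceNorm (ρ - σ)

/-! ### Super-operators -/

/-- Super-operators from register `a` to register `b`. -/
abbrev SuperOp (a b : Type*) := Matrix a a ℂ →ₗ[ℂ] Matrix b b ℂ

/-- `Φ ⊗ 1`: the super-operator `Φ` applied to the first factor of a bipartite register. -/
def SuperOp.onFst {a b : Type*} (Φ : SuperOp a b) (z : Type*) : SuperOp (a × z) (b × z) where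
  toFun M := Matrix.of fun p q => Φ (Matrix.of fun x y => M (x, p.2) (y, q.2)) p.1 q.1
  map_add' M N := by
    ext p q
    exact congrFun (congrFun (Φ.map_add (Matrix.of fun x y => M (x, p.2) (y, q.2))
      (Matrix.of fun x y => N (x, p.2) (y, q.2))) p.1) q.1
  map_smul' c M := by
    ext p q
    exact congrFun (congrFun (Φ.map_smul c (Matrix.of fun x y => M (x, p.2) (y, q.2))) p.1) q.1

/-- `1 ⊗ Φ`: the super-operator `Φ` applied to the second factor of a bipartite register. -/
def SuperOp.onSnd {a b : Type*} (Φ : SuperOp a b) (z : Type*) : SuperOp (z × a) (z × b) where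
  toFun M := Matrix.of fun p q => Φ (Matrix.of fun x y => M (p.1, x) (q.1, y)) p.2 q.2
  map_add' M N := by
    ext p q
    exact congrFun (congrFun (Φ.map_add (Matrix.of fun x y => M (p.1, x) (q.1, y))
      (Matrix.of fun x y => N (p.1, x) (q.1, y))) p.2) q.2
  map_smul' c M := by
    ext p q
    exact congrFun (congrFun (Φ.map_smul c (Matrix.of fun x y => M (p.1, x) (q.1, y))) p.2) q.2

/-- The tensor product `Φ ⊗ Ψ` of two super-operators. -/
def SuperOp.tensor {a b c d : Type*} (Φ : SuperOp a b) (Ψ : SuperOp c d) :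
    SuperOp (a × c) (b × d) :=
  (Ψ.onSnd b).comp (Φ.onFst c)

theorem SuperOp.onFst_kronecker {a b z : Type*} (Φ : SuperOp a b) (M : Matrix a a ℂ)
    (N : Matrix z z ℂ) : Φ.onFst z (M ⊗ₖ N) = Φ M ⊗ₖ N := by
  ext p q
  have h : (Matrix.of fun x y => (M ⊗ₖ N) (x, p.2) (y, q.2)) = N p.2 q.2 • M := by
    ext x y
    simp [mul_comm]
  change Φ (Matrix.of fun x y => (M ⊗ₖ N) (x, p.2) (y, q.2)) p.1 q.1 = _
  rw [h, map_smul]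
  simp [Matrix.kroneckerMap_apply, mul_comm]

theorem SuperOp.onSnd_kronecker {a b z : Type*} (Φ : SuperOp a b) (M : Matrix a a ℂ)
    (N : Matrix z z ℂ) : Φ.onSnd z (N ⊗ₖ M) = N ⊗ₖ Φ M := by
  ext p q
  have h : (Matrix.of fun x y => (N ⊗ₖ M) (p.1, x) (q.1, y)) = N p.1 q.1 • M := by
    ext x y
    simp
  change Φ (Matrix.of fun x y => (N ⊗ₖ M) (p.1, x) (q.1, y)) p.2 q.2 = _
  rw [h, map_smul]
  simp [Matrix.kroneckerMap_apply]

theorem SuperOp.tensor_kronecker {a b c d : Type*} (Φ : SuperOp a b) (Ψ : SuperOp c d)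
    (M : Matrix a a ℂ) (N : Matrix c c ℂ) : Φ.tensor Ψ (M ⊗ₖ N) = Φ M ⊗ₖ Ψ N := by
  simp [SuperOp.tensor, SuperOp.onFst_kronecker, SuperOp.onSnd_kronecker]

/-- Quantum operations: completely positive and trace preserving super-operators. -/
structure QuantumOp (a b : Type*) [Fintype a] [Fintype b] where
  toSuperOp : SuperOp a b
  completelyPositive : ∀ (k : ℕ) (M : Matrix (a × Fin k) (a × Fin k) ℂ),
    M.PosSemidef → (toSuperOp.onFst (Fin k) M).PosSemidef
  tracePreserving : ∀ M : Matrix a a ℂ, (toSuperOp M).trace = M.trace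

/-- Relabelling of the basis of a register. -/
abbrev relabel {a b : Type*} (e : a ≃ b) : SuperOp a b :=
  (Matrix.reindexLinearEquiv ℂ ℂ e e).toLinearMap

/-! ### Two-party strategies with oracle calls

The steps `1, …, n` are indexed by `Fin n`: step number `i + 1` is the index `i : Fin n`, it starts
with the memory space of index `i.castSucc` and ends with the memory space of index `i.succ`.
-/

/-- A tuple of `n` oracles; oracle `i` is a quantum operation on `regA i ⊗ regB i`. -/
structure Oracles (n : ℕ) where
  regA : Fin n → Type
  regB : Fin n → Type
  [fintypeA : ∀ i, Fintype (regA i)]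
  [fintypeB : ∀ i, Fintype (regB i)]
  op : ∀ i, QuantumOp (regA i × regB i) (regA i × regB i)

attribute [instance] Oracles.fintypeA Oracles.fintypeB

/-- The behaviour of one party with input space `X` in an `n`-step strategy, when `O i` is this
party's register for the `i`-th oracle call. The memory space of index `0` is the input space;
after each step the memory space splits into the register passed to the oracle and a register
`priv` that the party keeps. -/
structure Party (n : ℕ) (X : Type) (O : Fin n → Type) where
  mem : Fin (n + 1) → Type
  [fintypeMem : ∀ i, Fintype (mem i)]
  [decEqMem : ∀ i, DecidableEq (mem i)]
  input : X ≃ mem 0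
  priv : Fin n → Type
  [fintypePriv : ∀ i, Fintype (priv i)]
  split : ∀ i : Fin n, mem i.succ ≃ O i × priv i
  op : ∀ i : Fin n, QuantumOp (mem i.castSucc) (mem i.succ)

attribute [instance] Party.fintypeMem Party.decEqMem Party.fintypePriv

section Strategy

variable {n : ℕ} {X Y : Type} (orc : Oracles n) (P : Party n X orc.regA) (Q : Party n Y orc.regB)

/-- Regrouping of the joint memory after a step into oracle registers and private registers. -/
def regroup (i : Fin n) :
    P.mem i.succ × Q.mem i.succ ≃ (orc.regA i × orc.regB i) × (P.priv i × Q.priv i) :=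
  ((P.split i).prodCongr (Q.split i)).trans (Equiv.prodProdProdComm _ _ _ _)

/-- The `i`-th oracle call, acting on the joint memory of the two parties. -/
def oracleCall (i : Fin n) :
    SuperOp (P.mem i.succ × Q.mem i.succ) (P.mem i.succ × Q.mem i.succ) :=
  relabel (regroup orc P Q i).symm ∘ₗ
    (orc.op i).toSuperOp.onFst (P.priv i × Q.priv i) ∘ₗ relabel (regroup orc P Q i)

/-- One step: both parties apply their operations, then the oracle is called. -/
def step (i : Fin n) :
    SuperOp (P.mem i.castSucc × Q.mem i.castSucc) (P.mem i.succ × Q.mem i.succ) :=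
  oracleCall orc P Q i ∘ₗ (P.op i).toSuperOp.tensor (Q.op i).toSuperOp

/-- The joint state of the two parties and of the reference system `R` on input `ρ`, at the start
(index `0`) and after each step (index `i.succ`). -/
def state {R : Type} (ρ : Matrix ((X × Y) × R) ((X × Y) × R) ℂ) (i : Fin (n + 1)) :
    Matrix ((P.mem i × Q.mem i) × R) ((P.mem i × Q.mem i) × R) ℂ :=
  Fin.induction
    (motive := fun i => Matrix ((P.mem i × Q.mem i) × R) ((P.mem i × Q.mem i) × R) ℂ)
    (relabel ((P.input.prodCongr Q.input).prodCongr (Equiv.refl R)) ρ)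
    (fun i σ => (step orc P Q i).onFst R σ) i

/-- The final state `[P ⊛ Q](ρ)`. -/
def finalState {R : Type} (ρ : Matrix ((X × Y) × R) ((X × Y) × R) ℂ) :
    Matrix ((P.mem (Fin.last n) × Q.mem (Fin.last n)) × R)
      ((P.mem (Fin.last n) × Q.mem (Fin.last n)) × R) ℂ :=
  state orc P Q ρ (Fin.last n)

end Strategy

/-! ### Protocols, correctness, specious adversaries -/

/-- An `n`-step two-party protocol with oracle calls, for input spaces `X` and `Y`: an `n`-step
strategy whose final memory spaces are identified with the input spaces. -/
structure Protocol (n : ℕ) (X Y : Type) where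
  orc : Oracles n
  alice : Party n X orc.regA
  bob : Party n Y orc.regB
  outA : X ≃ alice.mem (Fin.last n)
  outB : Y ≃ bob.mem (Fin.last n)

namespace Protocol

variable {n : ℕ} {X Y : Type} [Fintype X] [DecidableEq X] [Fintype Y] [DecidableEq Y]

/-- The ideal output `(U ⊗ 1_R) · ρ`, as a state of the final memory spaces and `R`. -/
def ideal (π : Protocol n X Y) (U : Matrix.unitaryGroup (X × Y) ℂ) {R : Type} [Fintype R]
    [DecidableEq R] (ρ : Matrix ((X × Y) × R) ((X × Y) × R) ℂ) :
    Matrix ((π.alice.mem (Fin.last n) × π.bob.mem (Fin.last n)) × R)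
      ((π.alice.mem (Fin.last n) × π.bob.mem (Fin.last n)) × R) ℂ :=
  relabel ((π.outA.prodCongr π.outB).prodCongr (Equiv.refl R))
    (conj ((U : Matrix (X × Y) (X × Y) ℂ) ⊗ₖ (1 : Matrix R R ℂ)) ρ)

/-- `ε`-correctness of a protocol for the evaluation of `U`, with reference system `R`. -/
def IsCorrect (π : Protocol n X Y) (U : Matrix.unitaryGroup (X × Y) ℂ) (R : Type) [Fintype R]
    [DecidableEq R] (ε : ℝ) : Prop :=
  ∀ ρ : Matrix ((X × Y) × R) ((X × Y) × R) ℂ, IsDensity ρ →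
    traceDist (finalState π.orc π.alice π.bob ρ) (π.ideal U ρ) ≤ ε

/-- The adversary `A'` in the role of Alice is `ε`-specious: after every step, some quantum
operation on its register turns the joint state into one that is `ε`-close to the honest one. -/
def IsSpeciousA (π : Protocol n X Y) (A' : Party n X π.orc.regA) (R : Type) [Fintype R]
    [DecidableEq R] (ε : ℝ) : Prop :=
  ∃ t : ∀ i : Fin n, QuantumOp (A'.mem i.succ) (π.alice.mem i.succ),
    ∀ ρ : Matrix ((X × Y) × R) ((X × Y) × R) ℂ, IsDensity ρ → ∀ i : Fin n,
      traceDist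
        (((t i).toSuperOp.onFst (π.bob.mem i.succ)).onFst R
          (state π.orc A' π.bob ρ i.succ))
        (state π.orc π.alice π.bob ρ i.succ) ≤ ε

/-- The adversary `B'` in the role of Bob is `ε`-specious. -/
def IsSpeciousB (π : Protocol n X Y) (B' : Party n Y π.orc.regB) (R : Type) [Fintype R]
    [DecidableEq R] (ε : ℝ) : Prop :=
  ∃ t : ∀ i : Fin n, QuantumOp (B'.mem i.succ) (π.bob.mem i.succ),
    ∀ ρ : Matrix ((X × Y) × R) ((X × Y) × R) ℂ, IsDensity ρ → ∀ i : Fin n,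
      traceDist
        (((t i).toSuperOp.onSnd (π.alice.mem i.succ)).onFst R
          (state π.orc π.alice B' ρ i.succ))
        (state π.orc π.alice π.bob ρ i.succ) ≤ ε

end Protocol

/-- Reordering of tensor factors `D ⊗ ((A ⊗ B) ⊗ R) ≃ ((A ⊗ D) ⊗ B) ⊗ R`. -/
def moveToA (D A B R : Type) : D × ((A × B) × R) ≃ ((A × D) × B) × R where
  toFun x := (((x.2.1.1, x.1), x.2.1.2), x.2.2)
  invFun y := (y.1.1.2, ((y.1.1.1, y.1.2), y.2))
  left_inv _ := rfl
  right_inv _ := rfl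

/-- Reordering of tensor factors `D ⊗ ((A ⊗ B) ⊗ R) ≃ (A ⊗ (B ⊗ D)) ⊗ R`. -/
def moveToB (D A B R : Type) : D × ((A × B) × R) ≃ (A × (B × D)) × R where
  toFun x := ((x.2.1.1, (x.2.1.2, x.1)), x.2.2)
  invFun y := (y.1.2.2, ((y.1.1, y.1.2.1), y.2))
  left_inv _ := rfl
  right_inv _ := rfl

end Specious

end

/-! Only the end of the protocol matters. Let `Ψ` be the channel from the inputs to the final joint
memory under the adversary, `t` the final recovery operation and `Z` the isometry of the ideal
output. By speciousness at the last step and correctness, `t` after `Ψ` is close to `ρ ↦ Z ρ Zᴴ`,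
through the honest final state. A channel close to conjugation by an isometry can leak almost
nothing about its input to its environment, so the environment ends up in a nearly fixed state.
Keeping the part of the environment created by a Stinespring isometry `T` of `t` gives the claim.

Quantitatively, let `V k` be the Kraus operators of the composite and `E ρ k = tr (Zᴴ V k ρ)`.
Testing on purifications shows that `E ρ` has squared norm at least `1 - δ` for every density `ρ`,
with `δ = 4ε`; on pure states that squared norm is at most `1`. Since `E` is linear in `ρ`, the
midpoint of two pure states also has an image of almost unit norm, and the parallelogram law forces
the images of the two to be close. Hence `E` is nearly constant on pure states, and `V k ≈ φ k • Z`
for one unit vector `φ` (`exists_unit_hsSq_sub_le`). Regrouping the index of `φ` into kept and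
discarded environment yields the state split off, and Hilbert–Schmidt closeness of Kraus operators
becomes trace distance (`exists_isDensity_traceDist_le`). -/

open scoped Matrix Kronecker ComplexOrder

namespace Specious

/-! ### Kraus decompositions -/

/-- `Φ` has a Kraus decomposition `Φ M = ∑ i, K i M (K i)ᴴ` with `∑ i, (K i)ᴴ K i = 1`. -/
def HasKraus {a b : Type} [Fintype a] [DecidableEq a] [Fintype b] (Φ : SuperOp a b) : Prop :=
  ∃ (κ : Type) (_ : Fintype κ) (_ : Nonempty κ) (K : κ → Matrix b a ℂ),
    (∀ M, Φ M = ∑ i, conj (K i) M) ∧ ∑ i, (K i)ᴴ * K i = 1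

section Kraus

variable {a b c z : Type} [Fintype a] [DecidableEq a] [Fintype b] [DecidableEq b] [Fintype c]
  [Fintype z] [DecidableEq z]

theorem conj_apply {a b : Type*} [Fintype a] (K : Matrix b a ℂ) (M : Matrix a a ℂ) (p q : b) :
    conj K M p q = ∑ x, ∑ y, K p x * M x y * star (K q y) := by
  simp only [conj, Matrix.mul_apply, Matrix.conjTranspose_apply, Finset.sum_mul]
  rw [Finset.sum_comm]

theorem conj_mul {a b c : Type*} [Fintype a] [Fintype b] (L : Matrix c b ℂ) (K : Matrix b a ℂ)
    (M : Matrix a a ℂ) : conj (L * K) M = conj L (conj K M) := by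
  simp only [conj, Matrix.conjTranspose_mul, Matrix.mul_assoc]

theorem conj_sum {a b ι : Type*} [Fintype a] [Fintype ι] (K : Matrix b a ℂ)
    (M : ι → Matrix a a ℂ) : conj K (∑ i, M i) = ∑ i, conj K (M i) := by
  simp only [conj, Matrix.mul_sum, Matrix.sum_mul]

open scoped MatrixOrder in
theorem exists_eq_conjTranspose_mul_self {a : Type*} [Fintype a] {M : Matrix a a ℂ}
    (hM : M.PosSemidef) : ∃ B : Matrix a a ℂ, M = Bᴴ * B := by
  classical
  exact CStarAlgebra.nonneg_iff_eq_star_mul_self.mp hM.nonneg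

omit [DecidableEq b] in
/-- The Kraus decomposition obtained from a factorisation of the Choi matrix. -/
theorem QuantumOp.hasKraus (Φ : QuantumOp a b) : HasKraus Φ.toSuperOp := by
  classical
  let e := Fintype.equivFin a
  -- The unnormalised maximally entangled vector; the image of its projector is the Choi matrix.
  let v : a × Fin (Fintype.card a) → ℂ := fun p => if e p.1 = p.2 then 1 else 0
  have hC := Φ.completelyPositive _ _ (Matrix.posSemidef_vecMulVec_self_star v)
  obtain ⟨B, hB⟩ := exists_eq_conjTranspose_mul_self hC
  have hentry : ∀ i j p q, Φ.toSuperOp (Matrix.single i j 1) p q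
      = ∑ m, star (B m (p, e i)) * B m (q, e j) := by
    intro i j p q
    have h := congrFun (congrFun hB (p, e i)) (q, e j)
    rw [Matrix.mul_apply] at h
    simp only [Matrix.conjTranspose_apply] at h
    rw [← h]
    change _ = Φ.toSuperOp _ p q
    refine congrFun (congrFun (congrArg _ ?_) p) q
    ext x y
    simp [v, Matrix.vecMulVec_apply, Matrix.single_apply, eq_comm, ← ite_and, and_comm]
  -- The extra index `none` carries a zero operator, so that the family is nonempty even on an empty
  -- register.
  let K : Option (b × Fin (Fintype.card a)) → Matrix b a ℂ := fun m =>
    m.elim 0 fun m => Matrix.of fun p i => star (B m (p, e i))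
  have hK : ∀ M, Φ.toSuperOp M = ∑ m, conj (K m) M := by
    intro M
    ext p q
    conv_lhs => rw [Matrix.matrix_eq_sum_single M]
    have hs : ∀ i j, Matrix.single i j (M i j) = M i j • Matrix.single i j (1 : ℂ) := by
      intro i j; simp [Matrix.smul_single]
    simp only [hs, map_sum, map_smul, Matrix.sum_apply, Matrix.smul_apply, hentry, smul_eq_mul]
    rw [Fintype.sum_option]
    simp only [K, Option.elim, conj_apply, Matrix.of_apply, star_star, Matrix.zero_apply, zero_mul,
      Finset.sum_const_zero, zero_add, Finset.mul_sum]
    rw [Finset.sum_comm' (t' := Finset.univ) (s' := fun _ => Finset.univ) (by simp)]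
    simp only [Finset.sum_comm (s := (Finset.univ : Finset (b × Fin (Fintype.card a))))]
    rw [Finset.sum_comm]
    refine Finset.sum_congr rfl fun i _ => Finset.sum_congr rfl fun j _ =>
      Finset.sum_congr rfl fun m _ => by ring
  refine ⟨_, inferInstance, inferInstance, K, hK, ?_⟩
  ext i j
  have h := Φ.tracePreserving (Matrix.single j i 1)
  rw [hK, Matrix.trace_sum] at h
  have h2 : ∀ m, (conj (K m) (Matrix.single j i 1)).trace = ((K m)ᴴ * K m) i j := by
    intro m
    rw [conj, Matrix.trace_mul_comm, ← Matrix.mul_assoc, Matrix.trace_mul_single]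
    simp
  simp only [h2] at h
  rw [Matrix.sum_apply, h]
  by_cases hij : i = j
  · subst hij; simp
  · rw [Matrix.trace_single_eq_of_ne _ _ _ (Ne.symm hij), Matrix.one_apply_ne hij]

omit [DecidableEq a] [Fintype b] [DecidableEq b] in
theorem onFst_eq_sum_conj {κ : Type*} [Fintype κ] {Φ : SuperOp a b} {K : κ → Matrix b a ℂ}
    (h : ∀ M, Φ M = ∑ i, conj (K i) M) (M : Matrix (a × z) (a × z) ℂ) :
    Φ.onFst z M = ∑ i, conj (K i ⊗ₖ (1 : Matrix z z ℂ)) M := by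
  ext p q
  change Φ _ p.1 q.1 = _
  rw [h, Matrix.sum_apply, Matrix.sum_apply]
  refine Finset.sum_congr rfl fun i _ => ?_
  simp [conj_apply, Fintype.sum_prod_type, Matrix.one_apply, apply_ite (starRingEnd ℂ)]

omit [DecidableEq a] [Fintype b] [DecidableEq b] in
theorem onSnd_eq_sum_conj {κ : Type*} [Fintype κ] {Φ : SuperOp a b} {K : κ → Matrix b a ℂ}
    (h : ∀ M, Φ M = ∑ i, conj (K i) M) (M : Matrix (z × a) (z × a) ℂ) :
    Φ.onSnd z M = ∑ i, conj ((1 : Matrix z z ℂ) ⊗ₖ K i) M := by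
  ext p q
  change Φ _ p.2 q.2 = _
  rw [h, Matrix.sum_apply, Matrix.sum_apply]
  refine Finset.sum_congr rfl fun i _ => ?_
  simp [conj_apply, Fintype.sum_prod_type, Matrix.one_apply, apply_ite (starRingEnd ℂ)]

theorem sum_kronecker_one {a b z κ : Type*} [Fintype b] [DecidableEq a] [Fintype z]
    [DecidableEq z] [Fintype κ] {K : κ → Matrix b a ℂ} (h : ∑ i, (K i)ᴴ * K i = 1) :
    ∑ i, (K i ⊗ₖ (1 : Matrix z z ℂ))ᴴ * (K i ⊗ₖ (1 : Matrix z z ℂ)) = 1 := by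
  simp only [Matrix.conjTranspose_kronecker, ← Matrix.mul_kronecker_mul, Matrix.conjTranspose_one,
    mul_one]
  rw [← Matrix.one_kronecker_one, ← h]
  ext p q
  simp [Matrix.sum_apply, Finset.sum_mul]

theorem sum_one_kronecker {a b z κ : Type*} [Fintype b] [DecidableEq a] [Fintype z]
    [DecidableEq z] [Fintype κ] {K : κ → Matrix b a ℂ} (h : ∑ i, (K i)ᴴ * K i = 1) :
    ∑ i, ((1 : Matrix z z ℂ) ⊗ₖ K i)ᴴ * ((1 : Matrix z z ℂ) ⊗ₖ K i) = 1 := by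
  simp only [Matrix.conjTranspose_kronecker, ← Matrix.mul_kronecker_mul, Matrix.conjTranspose_one,
    mul_one]
  rw [← Matrix.one_kronecker_one, ← h]
  ext p q
  simp [Matrix.sum_apply, Finset.mul_sum]

theorem sum_conjTranspose_mul_mul {a b c κ ι : Type*} [DecidableEq a] [Fintype b] [DecidableEq b]
    [Fintype c] [Fintype κ] [Fintype ι] {L : ι → Matrix c b ℂ} {K : κ → Matrix b a ℂ}
    (hL : ∑ i, (L i)ᴴ * L i = 1) (hK : ∑ i, (K i)ᴴ * K i = 1) :
    ∑ i : ι × κ, (L i.1 * K i.2)ᴴ * (L i.1 * K i.2) = 1 := by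
  rw [← hK, Fintype.sum_prod_type_right]
  refine Finset.sum_congr rfl fun i _ => ?_
  have : (K i)ᴴ * (∑ j, (L j)ᴴ * L j) * K i = (K i)ᴴ * K i := by rw [hL, Matrix.mul_one]
  rw [← this, Matrix.mul_sum, Matrix.sum_mul]
  simp only [Matrix.conjTranspose_mul, Matrix.mul_assoc]

theorem comp_eq_sum_conj {a b c κ ι : Type*} [Fintype a] [Fintype b] [Fintype κ] [Fintype ι]
    {Ψ : SuperOp b c} {Φ : SuperOp a b} {L : ι → Matrix c b ℂ} {K : κ → Matrix b a ℂ}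
    (hL : ∀ M, Ψ M = ∑ i, conj (L i) M) (hK : ∀ M, Φ M = ∑ i, conj (K i) M)
    (M : Matrix a a ℂ) : (Ψ ∘ₗ Φ) M = ∑ i : ι × κ, conj (L i.1 * K i.2) M := by
  rw [LinearMap.comp_apply, hK, map_sum, Fintype.sum_prod_type_right]
  simp only [hL, conj_mul]

omit [DecidableEq b] in
theorem HasKraus.onFst {Φ : SuperOp a b} (h : HasKraus Φ) : HasKraus (Φ.onFst z) := by
  obtain ⟨κ, _, _, K, hK, h1⟩ := h
  exact ⟨κ, inferInstance, inferInstance, fun i => K i ⊗ₖ 1, onFst_eq_sum_conj hK,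
    sum_kronecker_one h1⟩

omit [DecidableEq b] in
theorem HasKraus.onSnd {Φ : SuperOp a b} (h : HasKraus Φ) : HasKraus (Φ.onSnd z) := by
  obtain ⟨κ, _, _, K, hK, h1⟩ := h
  exact ⟨κ, inferInstance, inferInstance, fun i => 1 ⊗ₖ K i, onSnd_eq_sum_conj hK,
    sum_one_kronecker h1⟩

theorem HasKraus.comp {Ψ : SuperOp b c} {Φ : SuperOp a b} (hΨ : HasKraus Ψ) (hΦ : HasKraus Φ) :
    HasKraus (Ψ ∘ₗ Φ) := by
  obtain ⟨κ, _, _, K, hK, h1⟩ := hΦ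
  obtain ⟨ι, _, _, L, hL, h2⟩ := hΨ
  exact ⟨ι × κ, inferInstance, inferInstance, fun i => L i.1 * K i.2, comp_eq_sum_conj hL hK,
    sum_conjTranspose_mul_mul h2 h1⟩

omit [DecidableEq b] in
theorem HasKraus.exists_fin {Φ : SuperOp a b} (h : HasKraus Φ) :
    ∃ (d : ℕ) (_ : Nonempty (Fin d)) (K : Fin d → Matrix b a ℂ),
      (∀ M, Φ M = ∑ i, conj (K i) M) ∧ ∑ i, (K i)ᴴ * K i = 1 := by
  obtain ⟨κ, _, _, K, hK, h1⟩ := h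
  let e := (Fintype.equivFin κ).symm
  refine ⟨Fintype.card κ, e.nonempty, K ∘ e, fun M => ?_, ?_⟩
  · rw [hK]; exact (e.sum_comp fun i => conj (K i) M).symm
  · rw [← h1]; exact e.sum_comp fun i => (K i)ᴴ * K i

omit [Fintype b] [DecidableEq b] in
theorem relabel_eq_conj (e : a ≃ b) (M : Matrix a a ℂ) :
    relabel e M = conj ((1 : Matrix a a ℂ).submatrix e.symm id) M := by
  ext p q
  simp [conj_apply, Matrix.one_apply]

omit [DecidableEq b] in
theorem hasKraus_relabel (e : a ≃ b) : HasKraus (relabel e) := by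
  refine ⟨Unit, inferInstance, inferInstance, fun _ => (1 : Matrix a a ℂ).submatrix e.symm id,
    fun M => by simp [relabel_eq_conj], ?_⟩
  simp only [Finset.univ_unique, Finset.sum_singleton, Matrix.conjTranspose_submatrix]
  rw [Matrix.submatrix_mul_equiv _ _ id e.symm id]
  simp

end Kraus

/-! ### The joint state as the image of the input under a channel -/

section State

variable {n : ℕ} {X Y : Type} [Fintype X] [DecidableEq X] [Fintype Y] [DecidableEq Y]
  (orc : Oracles n) (P : Party n X orc.regA) (Q : Party n Y orc.regB)

omit [Fintype X] [DecidableEq X] [Fintype Y] [DecidableEq Y] in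
theorem hasKraus_step (i : Fin n) : HasKraus (step orc P Q i) := by
  classical
  unfold step oracleCall SuperOp.tensor
  exact ((hasKraus_relabel _).comp ((orc.op i).hasKraus.onFst.comp (hasKraus_relabel _))).comp
    ((Q.op i).hasKraus.onSnd.comp (P.op i).hasKraus.onFst)

/-- The reference is a spectator in every step, so one channel `Ψ` serves all `R` and all inputs. -/
theorem exists_hasKraus_state (i : Fin (n + 1)) :
    ∃ Ψ : SuperOp (X × Y) (P.mem i × Q.mem i), HasKraus Ψ ∧
      ∀ {R : Type} (ρ : Matrix ((X × Y) × R) ((X × Y) × R) ℂ),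
        state orc P Q ρ i = Ψ.onFst R ρ := by
  induction i using Fin.induction with
  | zero => exact ⟨relabel (P.input.prodCongr Q.input), hasKraus_relabel _, fun ρ => rfl⟩
  | succ i ih =>
    obtain ⟨Ψ, hΨ, h⟩ := ih
    refine ⟨step orc P Q i ∘ₗ Ψ, (hasKraus_step orc P Q i).comp hΨ, fun {R} ρ => ?_⟩
    have : state orc P Q ρ i.succ = (step orc P Q i).onFst R (state orc P Q ρ i.castSucc) := rfl
    rw [this, h]
    rfl

end State

end Specious

namespace Specious

/-! ### Hilbert–Schmidt norm -/

/-- The square of the Hilbert–Schmidt norm. -/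
noncomputable def hsSq {a b : Type*} [Fintype a] [Fintype b] (A : Matrix a b ℂ) : ℝ := ∑ i, ∑ j, ‖A i j‖ ^ 2

section HilbertSchmidt

variable {a b c : Type*} [Fintype a] [Fintype b] [Fintype c]

theorem hsSq_nonneg (A : Matrix a b ℂ) : 0 ≤ hsSq A := by
  unfold hsSq; positivity

theorem trace_conjTranspose_mul_self (A : Matrix a b ℂ) : (Aᴴ * A).trace = (hsSq A : ℂ) := by
  simp only [hsSq, Matrix.trace, Matrix.diag_apply, Matrix.mul_apply, Matrix.conjTranspose_apply]
  rw [Finset.sum_comm]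
  push_cast
  refine Finset.sum_congr rfl fun i _ => Finset.sum_congr rfl fun j _ => ?_
  rw [← Complex.conj_mul']; rfl

theorem hsSq_eq (A : Matrix a b ℂ) : hsSq A = (Aᴴ * A).trace.re := by
  rw [trace_conjTranspose_mul_self, Complex.ofReal_re]

theorem hsSq_conjTranspose (A : Matrix a b ℂ) : hsSq Aᴴ = hsSq A := by
  simp only [hsSq, Matrix.conjTranspose_apply, norm_star]
  rw [Finset.sum_comm]

theorem hsSq_smul (x : ℂ) (A : Matrix a b ℂ) : hsSq (x • A) = ‖x‖ ^ 2 * hsSq A := by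
  simp [hsSq, Finset.mul_sum, mul_pow]

theorem norm_trace_conjTranspose_mul_le (A B : Matrix a b ℂ) :
    ‖(Aᴴ * B).trace‖ ≤ √(hsSq A) * √(hsSq B) := by
  have h1 : (Aᴴ * B).trace = ∑ p : a × b, star (A p.1 p.2) * B p.1 p.2 := by
    simp only [Matrix.trace, Matrix.diag_apply, Matrix.mul_apply, Matrix.conjTranspose_apply]
    rw [Finset.sum_comm, Fintype.sum_prod_type]
  have h2 : ∀ A : Matrix a b ℂ, hsSq A = ∑ p : a × b, ‖A p.1 p.2‖ ^ 2 := fun A => by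
    rw [Fintype.sum_prod_type]; rfl
  rw [h1, h2, h2]
  refine (norm_sum_le _ _).trans ?_
  simp only [norm_mul, norm_star]
  exact Real.sum_mul_le_sqrt_mul_sqrt _ _ _

theorem hsSq_add_add_le (A B C : Matrix a b ℂ) :
    hsSq (A + B + C) ≤ 3 * (hsSq A + hsSq B + hsSq C) := by
  simp only [hsSq, ← Finset.sum_add_distrib, Finset.mul_sum]
  refine Finset.sum_le_sum fun i _ => Finset.sum_le_sum fun j _ => ?_
  have h := norm_add₃_le (a := A i j) (b := B i j) (c := C i j)
  have h0 : 0 ≤ ‖A i j + B i j + C i j‖ := norm_nonneg _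
  simp only [Matrix.add_apply]
  nlinarith [sq_nonneg (‖A i j‖ - ‖B i j‖), sq_nonneg (‖A i j‖ - ‖C i j‖),
    sq_nonneg (‖B i j‖ - ‖C i j‖), norm_nonneg (A i j), norm_nonneg (B i j), norm_nonneg (C i j)]

theorem hsSq_mul_of_conjTranspose_mul_self [DecidableEq b] {U : Matrix a b ℂ} (hU : Uᴴ * U = 1)
    (A : Matrix b c ℂ) : hsSq (U * A) = hsSq A := by
  rw [hsSq_eq, hsSq_eq, Matrix.conjTranspose_mul, Matrix.mul_assoc, ← Matrix.mul_assoc Uᴴ, hU,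
    Matrix.one_mul]

theorem sum_hsSq_mul {κ : Type*} [Fintype κ] [DecidableEq b] {V : κ → Matrix a b ℂ}
    (hV : ∑ k, (V k)ᴴ * V k = 1) (A : Matrix b c ℂ) : ∑ k, hsSq (V k * A) = hsSq A := by
  have h : ∀ k, hsSq (V k * A) = (Aᴴ * ((V k)ᴴ * V k) * A).trace.re := fun k => by
    rw [hsSq_eq, Matrix.conjTranspose_mul]; simp only [Matrix.mul_assoc]
  simp only [h]
  rw [← Complex.re_sum, ← Matrix.trace_sum, ← Matrix.sum_mul, ← Matrix.mul_sum, hV, Matrix.mul_one,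
    hsSq_eq]

end HilbertSchmidt

/-! ### Trace norm -/

section TraceNorm

variable {a κ : Type*} [Fintype a] [DecidableEq a] [Fintype κ]

theorem traceNorm_nonneg (X : Matrix a a ℂ) : 0 ≤ traceNorm X :=
  Finset.sum_nonneg fun _ _ => Real.sqrt_nonneg _

/-- Here `s` lists the singular values and `W` the right singular vectors; this replaces matrix
square roots below. -/
theorem exists_unitary_diagonal (X : Matrix a a ℂ) :
    ∃ (W : Matrix a a ℂ) (s : a → ℝ), Wᴴ * W = 1 ∧ W * Wᴴ = 1 ∧ (∀ i, 0 ≤ s i) ∧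
      Xᴴ * X = W * Matrix.diagonal (fun i => ((s i ^ 2 : ℝ) : ℂ)) * Wᴴ ∧
      traceNorm X = ∑ i, s i := by
  have hX := Matrix.isHermitian_conjTranspose_mul_self X
  have hnn : ∀ i, 0 ≤ hX.eigenvalues i :=
    (Matrix.posSemidef_conjTranspose_mul_self X).eigenvalues_nonneg
  refine ⟨hX.eigenvectorUnitary, fun i => √(hX.eigenvalues i),
    Matrix.mem_unitaryGroup_iff'.mp hX.eigenvectorUnitary.2,
    Matrix.mem_unitaryGroup_iff.mp hX.eigenvectorUnitary.2, fun i => Real.sqrt_nonneg _, ?_, rfl⟩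
  conv_lhs => rw [hX.spectral_theorem]
  rw [Unitary.conjStarAlgAut_apply]
  congr 3
  ext i
  simp [Real.sq_sqrt (hnn i)]

/-- The trace norm is attained as `tr (C X)` with a contraction `C`. -/
theorem exists_contraction_trace_mul (X : Matrix a a ℂ) :
    ∃ C : Matrix a a ℂ, (∀ A : Matrix a κ ℂ, hsSq (C * A) ≤ hsSq A) ∧
      (C * X).trace = (traceNorm X : ℂ) := by
  obtain ⟨W, s, hW, hW', hs, hX, ht⟩ := exists_unitary_diagonal X
  -- The pseudo-inverse of the diagonal of singular values, since `0⁻¹ = 0`. Then `C` below is the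
  -- adjoint of the partial isometry in the polar decomposition of `X`.
  set D : Matrix a a ℂ := Matrix.diagonal fun i => (((s i)⁻¹ : ℝ) : ℂ) with hD
  set L : Matrix a a ℂ := Matrix.diagonal fun i => ((s i ^ 2 : ℝ) : ℂ) with hL
  have hDL : D * L = Matrix.diagonal fun i => ((s i : ℝ) : ℂ) := by
    rw [hD, hL, Matrix.diagonal_mul_diagonal]
    congr 1; ext i
    rw [← Complex.ofReal_mul, sq]
    by_cases h : s i = 0
    · simp [h]
    · congr 1; field_simp
  have hDLD : D * D * L * (D * D) = D * D := by
    rw [Matrix.mul_assoc D D L, hDL, hD]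
    simp only [Matrix.diagonal_mul_diagonal]
    congr 1; ext i
    simp only [← Complex.ofReal_mul]
    by_cases h : s i = 0
    · simp [h]
    · congr 1; field_simp
  have hDH : Dᴴ = D := by
    rw [hD, Matrix.diagonal_conjTranspose]
    congr 1; ext i; simp
  set C := W * D * Wᴴ * Xᴴ with hC
  refine ⟨C, fun A => ?_, ?_⟩
  · set Q := Cᴴ * C with hQ
    have hQ1 : Q = X * W * (D * D) * Wᴴ * Xᴴ := by
      rw [hQ, hC]
      simp only [Matrix.conjTranspose_mul, Matrix.conjTranspose_conjTranspose, hDH]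
      calc _ = X * (W * (D * ((Wᴴ * W) * (D * (Wᴴ * Xᴴ))))) := by simp only [Matrix.mul_assoc]
        _ = _ := by rw [hW, Matrix.one_mul]; simp only [Matrix.mul_assoc]
    have hQH : Qᴴ = Q := by rw [hQ, Matrix.conjTranspose_mul, Matrix.conjTranspose_conjTranspose]
    have hQQ : Q * Q = Q := by
      calc Q * Q = X * W * (D * D) * Wᴴ * (Xᴴ * X) * W * (D * D) * Wᴴ * Xᴴ := by
            rw [hQ1]; simp only [Matrix.mul_assoc]
        _ = X * W * (D * D) * (Wᴴ * W) * L * (Wᴴ * W) * (D * D) * Wᴴ * Xᴴ := by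
            rw [hX]; simp only [Matrix.mul_assoc]
        _ = X * W * (D * D * L * (D * D)) * Wᴴ * Xᴴ := by
            rw [hW]; simp only [Matrix.mul_assoc, Matrix.one_mul]
        _ = Q := by rw [hDLD, hQ1]
    -- `Q = Cᴴ C` is an orthogonal projection, so this is Pythagoras.
    have h1 : hsSq (C * A) + hsSq ((1 - Q) * A) = hsSq A := by
      simp only [hsSq_eq, ← Complex.add_re, ← Matrix.trace_add]
      congr 2
      calc _ = Aᴴ * (Q + (1 - Q)ᴴ * (1 - Q)) * A := by
            rw [hQ]
            simp only [Matrix.conjTranspose_mul, Matrix.mul_add, Matrix.add_mul, Matrix.mul_assoc]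
        _ = Aᴴ * A := by
            have : Q + (1 - Q)ᴴ * (1 - Q) = 1 := by
              rw [Matrix.conjTranspose_sub, Matrix.conjTranspose_one, hQH, Matrix.mul_sub, Matrix.sub_mul,
                Matrix.sub_mul, hQQ]
              simp
            rw [this, Matrix.mul_one]
    linarith [hsSq_nonneg ((1 - Q) * A)]
  · rw [hC, Matrix.mul_assoc, hX, ht]
    calc _ = (W * (D * ((Wᴴ * W) * (L * Wᴴ)))).trace := by simp only [Matrix.mul_assoc]
      _ = (W * (D * L) * Wᴴ).trace := by rw [hW, Matrix.one_mul]; simp only [Matrix.mul_assoc]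
      _ = _ := by
        rw [Matrix.trace_mul_cycle, hW, Matrix.one_mul, hDL, Matrix.trace_diagonal]
        push_cast; rfl

/-- Cauchy–Schwarz, together with the fact that the largest singular value is at most their sum.
With `A` a unit vector it turns trace distance into a bound on overlaps. -/
theorem norm_trace_conjTranspose_mul_mul_le (X : Matrix a a ℂ) (A : Matrix a κ ℂ) :
    ‖(Aᴴ * X * A).trace‖ ≤ traceNorm X * hsSq A := by
  obtain ⟨W, s, hW, hW', hs, hX, ht⟩ := exists_unitary_diagonal X
  have hle : ∀ i, s i ≤ traceNorm X := fun i => by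
    rw [ht]; exact Finset.single_le_sum (fun j _ => hs j) (Finset.mem_univ i)
  have h1 : hsSq (X * A) ≤ traceNorm X ^ 2 * hsSq A := by
    have h2 : hsSq (X * A) = hsSq (Matrix.diagonal (fun i => ((s i : ℝ) : ℂ)) * (Wᴴ * A)) := by
      rw [hsSq_eq, hsSq_eq]
      congr 2
      calc _ = Aᴴ * (Xᴴ * X) * A := by
            simp only [Matrix.conjTranspose_mul, Matrix.mul_assoc]
        _ = _ := by
          rw [hX]
          have : Matrix.diagonal (fun i => ((s i ^ 2 : ℝ) : ℂ))
              = (Matrix.diagonal (fun i => ((s i : ℝ) : ℂ)))ᴴ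
                * Matrix.diagonal (fun i => ((s i : ℝ) : ℂ)) := by
            rw [Matrix.diagonal_conjTranspose, Matrix.diagonal_mul_diagonal]
            congr 1; ext i; simp [sq]
          rw [this]
          simp only [Matrix.conjTranspose_mul, Matrix.conjTranspose_conjTranspose,
            Matrix.mul_assoc]
    have h3 : hsSq (Wᴴ * A) = hsSq A :=
      hsSq_mul_of_conjTranspose_mul_self (by rwa [Matrix.conjTranspose_conjTranspose]) A
    rw [h2, ← h3]
    simp only [hsSq, Matrix.diagonal_mul, Finset.mul_sum, norm_mul, mul_pow]
    refine Finset.sum_le_sum fun i _ => Finset.sum_le_sum fun j _ => ?_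
    refine mul_le_mul_of_nonneg_right ?_ (sq_nonneg _)
    rw [Complex.norm_real, Real.norm_of_nonneg (hs i)]
    exact pow_le_pow_left₀ (hs i) (hle i) 2
  rw [Matrix.mul_assoc]
  refine (norm_trace_conjTranspose_mul_le A (X * A)).trans ?_
  calc √(hsSq A) * √(hsSq (X * A)) ≤ √(hsSq A) * √(traceNorm X ^ 2 * hsSq A) := by gcongr
    _ = traceNorm X * (√(hsSq A) * √(hsSq A)) := by
      rw [Real.sqrt_mul (sq_nonneg _), Real.sqrt_sq (traceNorm_nonneg X)]; ring
    _ = _ := by rw [Real.mul_self_sqrt (hsSq_nonneg A)]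

/-- Hilbert–Schmidt closeness of `M` and `N` bounds the trace distance of `M Mᴴ` and `N Nᴴ`. -/
theorem traceNorm_mul_conjTranspose_sub_le (M N : Matrix a κ ℂ) :
    traceNorm (M * Mᴴ - N * Nᴴ) ≤ √(hsSq (M - N)) * (√(hsSq M) + √(hsSq N)) := by
  obtain ⟨C, hC, ht⟩ := exists_contraction_trace_mul (κ := κ) (M * Mᴴ - N * Nᴴ)
  have hb : ∀ A B : Matrix a κ ℂ, ‖(C * (A * Bᴴ)).trace‖ ≤ √(hsSq A) * √(hsSq B) := by
    intro A B
    rw [← Matrix.mul_assoc, Matrix.trace_mul_comm, mul_comm]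
    refine (norm_trace_conjTranspose_mul_le B (C * A)).trans ?_
    gcongr
    exact hC A
  have h : M * Mᴴ - N * Nᴴ = (M - N) * Mᴴ + N * (M - N)ᴴ := by
    rw [Matrix.conjTranspose_sub, Matrix.sub_mul, Matrix.mul_sub]; abel
  have h2 : traceNorm (M * Mᴴ - N * Nᴴ) = ‖(C * (M * Mᴴ - N * Nᴴ)).trace‖ := by
    rw [ht, Complex.norm_real, Real.norm_of_nonneg (traceNorm_nonneg _)]
  rw [h2, h, Matrix.mul_add, Matrix.trace_add]
  refine (norm_add_le _ _).trans ((add_le_add (hb _ _) (hb _ _)).trans (le_of_eq ?_))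
  ring

end TraceNorm

end Specious

namespace Specious

/-! ### Channels that act almost like an isometry factor out their environment -/

section Decoupling

variable {H G R κ : Type} [Fintype H] [DecidableEq H] [Fintype G] [Fintype R] [Fintype κ]

/-- Normalise `e`; if `e = 0`, every unit vector is at distance one. -/
theorem exists_unit_near [Nonempty κ] (e : κ → ℂ) :
    ∃ φ : κ → ℂ, ∑ k, ‖φ k‖ ^ 2 = 1 ∧
      ∑ k, ‖e k - φ k‖ ^ 2 = (1 - √(∑ k, ‖e k‖ ^ 2)) ^ 2 := by
  classical
  set s := ∑ k, ‖e k‖ ^ 2 with hs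
  have hs0 : 0 ≤ s := by positivity
  by_cases h : s = 0
  · have he : ∀ k, e k = 0 := fun k => by
      have := (Finset.sum_eq_zero_iff_of_nonneg (fun _ _ => sq_nonneg _)).mp h k (Finset.mem_univ k)
      simpa using this
    refine ⟨Pi.single (Classical.arbitrary κ) 1, ?_, ?_⟩ <;>
      simp [he, h, Pi.single_apply, apply_ite norm]
  · have hr : √s ≠ 0 := by rwa [Ne, Real.sqrt_eq_zero hs0]
    have hsq : √s ^ 2 = s := Real.sq_sqrt hs0
    refine ⟨fun k => ((√s)⁻¹ : ℝ) * e k, ?_, ?_⟩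
    · simp only [norm_mul, mul_pow, ← Finset.mul_sum, Complex.norm_real, ← hs, Real.norm_eq_abs,
        sq_abs, inv_pow, hsq]
      exact inv_mul_cancel₀ h
    · have : ∀ k, e k - ((√s)⁻¹ : ℝ) * e k = ((1 - (√s)⁻¹ : ℝ) : ℂ) * e k := fun k => by
        push_cast; ring
      simp only [this, norm_mul, mul_pow, ← Finset.mul_sum, Complex.norm_real, ← hs,
        Real.norm_eq_abs, sq_abs]
      nth_rewrite 2 [← hsq]
      rw [← mul_pow, sub_mul, one_mul, inv_mul_cancel₀ hr]
      ring

theorem hsSq_col_sum {a b : Type*} [Fintype a] [Fintype b] (A : Matrix a b ℂ) :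
    hsSq A = ∑ j, hsSq (A.submatrix id fun _ : Unit => j) := by
  simp only [hsSq, Matrix.submatrix_apply, id, Finset.univ_unique, Finset.sum_singleton]
  rw [Finset.sum_comm]

omit [DecidableEq H] in
-- Purification: read as a vector of the register `H × R`, the matrix `S` has reduced state `ρ`. It
-- exists because `R` is as large as `H`, which is where the dimension of the reference enters.
theorem exists_hsSq_eq_one_of_posSemidef (e : H ≃ R) {ρ : Matrix H H ℂ} (hρ : ρ.PosSemidef)
    (htr : ρ.trace = 1) : ∃ S : Matrix H R ℂ, hsSq S = 1 ∧ S * Sᴴ = ρ := by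
  obtain ⟨B, rfl⟩ := exists_eq_conjTranspose_mul_self hρ
  refine ⟨Bᴴ.submatrix id e.symm, ?_, ?_⟩
  · rw [← hsSq_conjTranspose, hsSq_eq, Matrix.conjTranspose_conjTranspose,
      Matrix.conjTranspose_submatrix, Matrix.submatrix_mul_equiv, Matrix.conjTranspose_conjTranspose,
      Matrix.submatrix_id_id, htr, Complex.one_re]
  · rw [Matrix.conjTranspose_submatrix, Matrix.submatrix_mul_equiv,
      Matrix.conjTranspose_conjTranspose, Matrix.submatrix_id_id]

/-- If the channel with Kraus operators `V k` is close to conjugation by the isometry `Z` on all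
pure states shared with a reference system, then `V k ≈ φ k • Z` for a unit vector `φ`. -/
theorem exists_unit_hsSq_sub_le [Nonempty H] [Nonempty κ] (e : H ≃ R) {V : κ → Matrix G H ℂ}
    {Z : Matrix G H ℂ} (hV : ∑ k, (V k)ᴴ * V k = 1) (hZ : Zᴴ * Z = 1) {δ : ℝ}
    (h : ∀ S : Matrix H R ℂ, hsSq S = 1 →
      1 - δ ≤ ∑ k, ‖((Z * S)ᴴ * (V k * S)).trace‖ ^ 2) :
    ∃ φ : κ → ℂ, ∑ k, ‖φ k‖ ^ 2 = 1 ∧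
      ∀ {m : Type} [Fintype m] (S : Matrix H m ℂ),
        ∑ k, hsSq (V k * S - φ k • (Z * S)) ≤ 18 * δ * hsSq S := by
  classical
  -- The overlap of branch `k` with the ideal output. Its linearity in `ρ` drives the argument.
  let E : Matrix H H ℂ → κ → ℂ := fun ρ k => (Zᴴ * V k * ρ).trace
  have hE : ∀ {m : Type} [Fintype m] (S : Matrix H m ℂ) k,
      ((Z * S)ᴴ * (V k * S)).trace = E (S * Sᴴ) k := by
    intro m _ S k
    simp only [E]
    rw [← Matrix.mul_assoc (Zᴴ * V k), Matrix.trace_mul_comm _ Sᴴ, Matrix.conjTranspose_mul]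
    simp only [Matrix.mul_assoc]
  have hlow : ∀ ρ : Matrix H H ℂ, ρ.PosSemidef → ρ.trace = 1 → 1 - δ ≤ ∑ k, ‖E ρ k‖ ^ 2 := by
    intro ρ hρ htr
    obtain ⟨S, hS, rfl⟩ := exists_hsSq_eq_one_of_posSemidef e hρ htr
    simpa only [hE] using h S hS
  -- `E (S * Sᴴ) k • (Z * S)` is the orthogonal projection of `V k * S` onto the unit vector `Z *
  -- S`, and the vectors `V k * S` have total squared norm one.
  have hsplit : ∀ S : Matrix H Unit ℂ, hsSq S = 1 →
      ∑ k, hsSq (V k * S - E (S * Sᴴ) k • (Z * S)) = 1 - ∑ k, ‖E (S * Sᴴ) k‖ ^ 2 := by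
    intro S hS
    rw [← hS, ← sum_hsSq_mul hV S, ← Finset.sum_sub_distrib]
    refine Finset.sum_congr rfl fun k _ => ?_
    have h1 : ((Z * S)ᴴ * (V k * S)).trace = E (S * Sᴴ) k := hE S k
    have h2 : ((V k * S)ᴴ * (Z * S)).trace = star (E (S * Sᴴ) k) := by
      rw [← h1, ← Matrix.trace_conjTranspose, Matrix.conjTranspose_mul _ (V k * S),
        Matrix.conjTranspose_conjTranspose]
    have h3 : ((Z * S)ᴴ * (Z * S)).trace = 1 := by
      rw [trace_conjTranspose_mul_self, hsSq_mul_of_conjTranspose_mul_self hZ, hS,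
        Complex.ofReal_one]
    set x := E (S * Sᴴ) k
    have h4 : star x * x = ((‖x‖ ^ 2 : ℝ) : ℂ) := by
      rw [Complex.star_def, Complex.conj_mul']; push_cast; rfl
    have : (((V k * S - x • (Z * S))ᴴ * (V k * S - x • (Z * S))).trace : ℂ)
        = ((hsSq (V k * S) - ‖x‖ ^ 2 : ℝ) : ℂ) := by
      simp only [Matrix.conjTranspose_sub, Matrix.conjTranspose_smul, Matrix.sub_mul,
        Matrix.mul_sub, Matrix.smul_mul, Matrix.mul_smul, Matrix.trace_sub, Matrix.trace_smul,
        smul_eq_mul, h1, h2, h3, trace_conjTranspose_mul_self (V k * S), h4]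
      push_cast; ring
    rw [hsSq_eq, this, Complex.ofReal_re]
  have hup : ∀ S : Matrix H Unit ℂ, hsSq S = 1 → ∑ k, ‖E (S * Sᴴ) k‖ ^ 2 ≤ 1 := by
    intro S hS
    have : 0 ≤ ∑ k, hsSq (V k * S - E (S * Sᴴ) k • (Z * S)) :=
      Finset.sum_nonneg fun _ _ => hsSq_nonneg _
    linarith [hsplit S hS]
  have hpure : ∀ S : Matrix H Unit ℂ, hsSq S = 1 →
      (S * Sᴴ).PosSemidef ∧ (S * Sᴴ).trace = 1 := fun S hS =>
    ⟨Matrix.posSemidef_self_mul_conjTranspose S, by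
      rw [Matrix.trace_mul_comm, trace_conjTranspose_mul_self, hS, Complex.ofReal_one]⟩
  have hdist : ∀ S T : Matrix H Unit ℂ, hsSq S = 1 → hsSq T = 1 →
      ∑ k, ‖E (S * Sᴴ) k - E (T * Tᴴ) k‖ ^ 2 ≤ 4 * δ := by
    intro S T hS hT
    obtain ⟨hS1, hS2⟩ := hpure S hS
    obtain ⟨hT1, hT2⟩ := hpure T hT
    -- The equal mixture of the two pure states is again a density, so the parallelogram law gives
    -- at most `2 + 2 - 4 (1 - δ) = 4 δ`.
    have hmid := hlow ((1 / 2 : ℝ) • (S * Sᴴ + T * Tᴴ))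
      ((hS1.add hT1).smul (by norm_num)) (by
        rw [Matrix.trace_smul, Matrix.trace_add, hS2, hT2]
        norm_num)
    have hk : ∀ k, ‖E (S * Sᴴ) k - E (T * Tᴴ) k‖ ^ 2 = 2 * ‖E (S * Sᴴ) k‖ ^ 2
        + 2 * ‖E (T * Tᴴ) k‖ ^ 2 - 4 * ‖E ((1 / 2 : ℝ) • (S * Sᴴ + T * Tᴴ)) k‖ ^ 2 := by
      intro k
      have : E ((1 / 2 : ℝ) • (S * Sᴴ + T * Tᴴ)) k
          = (1 / 2 : ℝ) • (E (S * Sᴴ) k + E (T * Tᴴ) k) := by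
        simp only [E, Matrix.mul_smul, Matrix.mul_add, Matrix.trace_smul, Matrix.trace_add]
      rw [this, norm_smul]
      have hp := parallelogram_law_with_norm ℝ (E (S * Sᴴ) k) (E (T * Tᴴ) k)
      norm_num
      nlinarith
    simp only [hk, Finset.sum_sub_distrib, Finset.sum_add_distrib, ← Finset.mul_sum]
    linarith [hup S hS, hup T hT]
  let S₀ : Matrix H Unit ℂ := Matrix.single (Classical.arbitrary H) () 1
  have hS₀ : hsSq S₀ = 1 := by
    rw [hsSq_eq]
    simp [S₀, Matrix.conjTranspose_single]
  obtain ⟨φ, hφ, hφe⟩ := exists_unit_near (E (S₀ * S₀ᴴ))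
  refine ⟨φ, hφ, ?_⟩
  -- For `0 ≤ s ≤ 1` one has `(1 - √s)² ≤ (1 - √s)(1 + √s) = 1 - s ≤ δ`.
  have hφδ : ∑ k, ‖E (S₀ * S₀ᴴ) k - φ k‖ ^ 2 ≤ δ := by
    rw [hφe]
    have h1 := hup S₀ hS₀
    have h2 := hlow _ (hpure S₀ hS₀).1 (hpure S₀ hS₀).2
    set s := ∑ k, ‖E (S₀ * S₀ᴴ) k‖ ^ 2
    have h0 : 0 ≤ s := by positivity
    have h3 := Real.sq_sqrt h0
    have h4 := Real.sqrt_nonneg s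
    have h5 : √s ≤ 1 := Real.sqrt_le_one.mpr h1
    nlinarith
  -- Pass from `V k` to `E (S * Sᴴ) k`, then to `E (S₀ * S₀ᴴ) k`, then to `φ k`: the constant is `3
  -- (δ + 4δ + δ)`.
  have hunit : ∀ S : Matrix H Unit ℂ, hsSq S = 1 →
      ∑ k, hsSq (V k * S - φ k • (Z * S)) ≤ 18 * δ := by
    intro S hS
    have hZS : hsSq (Z * S) = 1 := by rw [hsSq_mul_of_conjTranspose_mul_self hZ, hS]
    have hk : ∀ k, hsSq (V k * S - φ k • (Z * S)) ≤
        3 * (hsSq (V k * S - E (S * Sᴴ) k • (Z * S)) + ‖E (S * Sᴴ) k - E (S₀ * S₀ᴴ) k‖ ^ 2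
          + ‖E (S₀ * S₀ᴴ) k - φ k‖ ^ 2) := by
      intro k
      have := hsSq_add_add_le (V k * S - E (S * Sᴴ) k • (Z * S))
        ((E (S * Sᴴ) k - E (S₀ * S₀ᴴ) k) • (Z * S)) ((E (S₀ * S₀ᴴ) k - φ k) • (Z * S))
      rw [hsSq_smul, hsSq_smul, hZS, mul_one, mul_one] at this
      refine le_trans (le_of_eq ?_) this
      congr 1
      simp only [sub_smul]
      abel
    refine (Finset.sum_le_sum fun k _ => hk k).trans ?_
    rw [← Finset.mul_sum, Finset.sum_add_distrib, Finset.sum_add_distrib, hsplit S hS]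
    linarith [hdist S S₀ hS hS₀, hlow _ (hpure S hS).1 (hpure S hS).2]
  have hcol : ∀ S : Matrix H Unit ℂ,
      ∑ k, hsSq (V k * S - φ k • (Z * S)) ≤ 18 * δ * hsSq S := by
    intro S
    by_cases h0 : hsSq S = 0
    · have : S = 0 := by
        ext i j
        have h1 := (Finset.sum_eq_zero_iff_of_nonneg fun i _ =>
          Finset.sum_nonneg fun j _ => sq_nonneg ‖S i j‖).mp h0 i (Finset.mem_univ i)
        have h2 := (Finset.sum_eq_zero_iff_of_nonneg fun j _ => sq_nonneg ‖S i j‖).mp h1 j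
          (Finset.mem_univ j)
        simpa using h2
      simp [this, hsSq]
    · have hpos : 0 < hsSq S := lt_of_le_of_ne (hsSq_nonneg S) (Ne.symm h0)
      have hr : √(hsSq S) ≠ 0 := by positivity
      have hx : ‖((√(hsSq S))⁻¹ : ℂ)‖ ^ 2 = (hsSq S)⁻¹ := by
        rw [norm_inv, Complex.norm_real, Real.norm_of_nonneg (Real.sqrt_nonneg _), inv_pow,
          Real.sq_sqrt hpos.le]
      have h1 := hunit (((√(hsSq S))⁻¹ : ℂ) • S) (by
        rw [hsSq_smul, hx, inv_mul_cancel₀ h0])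
      have h2 : ∀ k, V k * (((√(hsSq S))⁻¹ : ℂ) • S) - φ k • (Z * (((√(hsSq S))⁻¹ : ℂ) • S))
          = ((√(hsSq S))⁻¹ : ℂ) • (V k * S - φ k • (Z * S)) := by
        intro k
        rw [Matrix.mul_smul, Matrix.mul_smul, smul_sub, smul_comm]
      simp only [h2, hsSq_smul, hx, ← Finset.mul_sum] at h1
      rwa [inv_mul_le_iff₀ hpos, mul_comm] at h1
  -- Both sides are sums over the columns of `S`, so vectors suffice.
  intro m _ S
  have hsub : ∀ k, hsSq (V k * S - φ k • (Z * S)) = ∑ j, hsSq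
      (V k * S.submatrix id (fun _ : Unit => j) - φ k • (Z * S.submatrix id (fun _ : Unit => j))) :=
    fun k => hsSq_col_sum _
  simp only [hsub]
  rw [Finset.sum_comm, hsSq_col_sum S, Finset.mul_sum]
  exact Finset.sum_le_sum fun j _ => hcol _

end Decoupling

end Specious

namespace Specious

/-! ### From trace distance to fidelity and back to trace distance -/

section Rushing

variable {H G R κ : Type} [Fintype H] [DecidableEq H] [Fintype G] [DecidableEq G] [Fintype R]
  [DecidableEq R] [Fintype κ]

/-- A matrix, seen as a vector of the bipartite register. -/
def vectorize {a b : Type*} (S : Matrix a b ℂ) : Matrix (a × b) Unit ℂ :=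
  Matrix.of fun p _ => S p.1 p.2

omit [DecidableEq H] [Fintype G] [DecidableEq G] in
theorem kronecker_one_mul_vectorize (Z : Matrix G H ℂ) (S : Matrix H R ℂ) :
    (Z ⊗ₖ (1 : Matrix R R ℂ)) * vectorize S = vectorize (Z * S) := by
  ext p u
  simp [vectorize, Matrix.mul_apply, Fintype.sum_prod_type, Matrix.one_apply]

theorem trace_vectorize {a b : Type*} [Fintype a] [Fintype b] (A B : Matrix a b ℂ) :
    ((vectorize A)ᴴ * vectorize B).trace = (Aᴴ * B).trace := by
  simp only [vectorize, Matrix.trace, Matrix.diag_apply, Matrix.mul_apply,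
    Matrix.conjTranspose_apply, Matrix.of_apply, Finset.univ_unique, Finset.sum_singleton,
    Fintype.sum_prod_type]
  rw [Finset.sum_comm]

theorem hsSq_vectorize {a b : Type*} [Fintype a] [Fintype b] (A : Matrix a b ℂ) :
    hsSq (vectorize A) = hsSq A := by
  rw [hsSq_eq, trace_vectorize, hsSq_eq]

theorem isDensity_mul_conjTranspose {a b : Type*} [Fintype a] [Fintype b] {S : Matrix a b ℂ}
    (hS : hsSq S = 1) : IsDensity (S * Sᴴ) :=
  ⟨Matrix.posSemidef_self_mul_conjTranspose S, by
    rw [Matrix.trace_mul_comm, trace_conjTranspose_mul_self, hS, Complex.ofReal_one]⟩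

theorem conj_mul_conjTranspose {a b c : Type*} [Fintype a] [Fintype b] (M : Matrix c a ℂ)
    (S : Matrix a b ℂ) : conj M (S * Sᴴ) = (M * S) * (M * S)ᴴ := by
  simp only [conj, Matrix.conjTranspose_mul, Matrix.mul_assoc]

theorem trace_unit_mul (A B : Matrix Unit Unit ℂ) : (A * B).trace = A.trace * B.trace := by
  simp [Matrix.trace, Matrix.mul_apply]

/-- A channel close in trace distance to conjugation by the isometry `Z` has entanglement fidelity
with `Z` close to one. -/
theorem one_sub_le_fidelity {V : κ → Matrix G H ℂ} {Z : Matrix G H ℂ} (hZ : Zᴴ * Z = 1) {ε : ℝ}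
    (h : ∀ ρ : Matrix (H × R) (H × R) ℂ, IsDensity ρ → ∃ ω,
      traceDist (∑ k, conj (V k ⊗ₖ (1 : Matrix R R ℂ)) ρ) ω ≤ ε ∧
      traceDist ω (conj (Z ⊗ₖ (1 : Matrix R R ℂ)) ρ) ≤ ε)
    (S : Matrix H R ℂ) (hS : hsSq S = 1) :
    1 - 4 * ε ≤ ∑ k, ‖((Z * S)ᴴ * (V k * S)).trace‖ ^ 2 := by
  obtain ⟨ω, h1, h2⟩ := h _ (isDensity_mul_conjTranspose (S := vectorize S)
    (by rw [hsSq_vectorize, hS]))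
  simp only [conj_mul_conjTranspose, kronecker_one_mul_vectorize] at h1 h2
  set A := vectorize (Z * S) with hA
  have hA1 : hsSq A = 1 := by
    rw [hA, hsSq_vectorize, hsSq_mul_of_conjTranspose_mul_self hZ, hS]
  have hI : ∀ B : Matrix (G × R) Unit ℂ,
      (Aᴴ * (B * Bᴴ) * A).trace = ((‖(Aᴴ * B).trace‖ ^ 2 : ℝ) : ℂ) := by
    intro B
    have : Aᴴ * (B * Bᴴ) * A = (Aᴴ * B) * (Aᴴ * B)ᴴ := by
      simp only [Matrix.conjTranspose_mul, Matrix.conjTranspose_conjTranspose, Matrix.mul_assoc]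
    rw [this, trace_unit_mul, Matrix.trace_conjTranspose, Complex.star_def, Complex.mul_conj']
    push_cast; rfl
  have hAA : (Aᴴ * (A * Aᴴ) * A).trace = 1 := by
    rw [hI, trace_conjTranspose_mul_self, hA1]; simp
  set σ := ∑ k, vectorize (V k * S) * (vectorize (V k * S))ᴴ with hσ
  have hV : (Aᴴ * σ * A).trace
      = ((∑ k, ‖((Z * S)ᴴ * (V k * S)).trace‖ ^ 2 : ℝ) : ℂ) := by
    rw [hσ, Matrix.mul_sum, Matrix.sum_mul, Matrix.trace_sum]
    simp only [hI]
    simp only [hA, trace_vectorize]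
    push_cast; rfl
  -- Each trace distance of at most `ε` is a trace norm of at most `2ε`; the two together cost `4ε`.
  have b1 := norm_trace_conjTranspose_mul_mul_le (σ - ω) A
  have b2 := norm_trace_conjTranspose_mul_mul_le (ω - A * Aᴴ) A
  rw [hA1, mul_one] at b1 b2
  have hsum : (Aᴴ * (σ - ω) * A).trace + (Aᴴ * (ω - A * Aᴴ) * A).trace
      = ((∑ k, ‖((Z * S)ᴴ * (V k * S)).trace‖ ^ 2 - 1 : ℝ) : ℂ) := by
    rw [← Matrix.trace_add, ← Matrix.add_mul, ← Matrix.mul_add, sub_add_sub_cancel, Matrix.mul_sub,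
      Matrix.sub_mul, Matrix.trace_sub, hV, hAA]
    push_cast; rfl
  have b3 := norm_add_le (Aᴴ * (σ - ω) * A).trace (Aᴴ * (ω - A * Aᴴ) * A).trace
  rw [hsum, Complex.norm_real, Real.norm_eq_abs] at b3
  have b4 := neg_abs_le (∑ k, ‖((Z * S)ᴴ * (V k * S)).trace‖ ^ 2 - 1)
  unfold traceDist at h1 h2
  linarith

/-- Channels with close Kraus operators are close in trace distance, also with a reference. -/
theorem traceDist_sum_conj_le {M N : κ → Matrix G H ℂ} (hM : ∑ k, (M k)ᴴ * M k = 1)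
    (hN : ∑ k, (N k)ᴴ * N k = 1) {c : ℝ}
    (h : ∀ {m : Type} [Fintype m] (S : Matrix H m ℂ),
      ∑ k, hsSq (M k * S - N k * S) ≤ c * hsSq S)
    {ρ : Matrix (H × R) (H × R) ℂ} (hρ : IsDensity ρ) :
    traceDist (∑ k, conj (M k ⊗ₖ (1 : Matrix R R ℂ)) ρ)
      (∑ k, conj (N k ⊗ₖ (1 : Matrix R R ℂ)) ρ) ≤ √c := by
  obtain ⟨S, hS, rfl⟩ :=
    exists_hsSq_eq_one_of_posSemidef (Equiv.refl _) hρ.posSemidef hρ.trace_eq_one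
  -- The branches placed side by side, so that the output of the channel is `row M * (row M)ᴴ`.
  let row : (κ → Matrix G H ℂ) → Matrix (G × R) (κ × (H × R)) ℂ := fun M =>
    Matrix.of fun p q => ((M q.1 ⊗ₖ (1 : Matrix R R ℂ)) * S) p q.2
  have hrow : ∀ M : κ → Matrix G H ℂ,
      ∑ k, conj (M k ⊗ₖ (1 : Matrix R R ℂ)) (S * Sᴴ) = row M * (row M)ᴴ := by
    intro M
    ext p q
    simp only [conj_mul_conjTranspose, Matrix.sum_apply]
    rw [Matrix.mul_apply, Fintype.sum_prod_type]
    exact Finset.sum_congr rfl fun k _ => Matrix.mul_apply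
  have hrow2 : ∀ f : κ → Matrix (G × R) (H × R) ℂ,
      hsSq (Matrix.of fun (p : G × R) (q : κ × (H × R)) => f q.1 p q.2) = ∑ k, hsSq (f k) := by
    intro f
    simp only [hsSq, Matrix.of_apply, Fintype.sum_prod_type (α₁ := κ)]
    rw [Finset.sum_comm]
  have h1 : ∀ {M : κ → Matrix G H ℂ}, ∑ k, (M k)ᴴ * M k = 1 → hsSq (row M) = 1 := by
    intro M hM
    rw [← hS, ← sum_hsSq_mul (sum_kronecker_one (z := R) hM) S]
    exact hrow2 fun k => (M k ⊗ₖ (1 : Matrix R R ℂ)) * S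
  have h2 : hsSq (row M - row N) ≤ c := by
    have e1 : hsSq (row M - row N) = ∑ k, hsSq
        ((M k ⊗ₖ (1 : Matrix R R ℂ)) * S - (N k ⊗ₖ (1 : Matrix R R ℂ)) * S) :=
      hrow2 fun k => (M k ⊗ₖ (1 : Matrix R R ℂ)) * S - (N k ⊗ₖ (1 : Matrix R R ℂ)) * S
    -- Moving the reference from the rows to the columns makes `h`, which mentions no reference,
    -- applicable.
    let S' : Matrix H (R × (H × R)) ℂ := Matrix.of fun x q => S (x, q.1) q.2
    have hS' : hsSq S' = 1 := by
      rw [← hS]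
      simp [hsSq, S', Fintype.sum_prod_type]
    have e2 : ∀ (M : Matrix G H ℂ) g r j,
        ((M ⊗ₖ (1 : Matrix R R ℂ)) * S) (g, r) j = (M * S') g (r, j) := by
      intro M g r j
      simp [S', Matrix.mul_apply, Fintype.sum_prod_type (α₁ := H), Matrix.one_apply]
    have e3 : ∀ k, hsSq ((M k ⊗ₖ (1 : Matrix R R ℂ)) * S - (N k ⊗ₖ (1 : Matrix R R ℂ)) * S)
        = hsSq (M k * S' - N k * S') := by
      intro k
      simp only [hsSq, Matrix.sub_apply, Fintype.sum_prod_type (α₁ := G), e2,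
        Fintype.sum_prod_type (α₁ := R) (α₂ := H × R)]
    rw [e1]
    simp only [e3]
    simpa [hS'] using h S'
  rw [hrow, hrow, traceDist]
  have h3 := traceNorm_mul_conjTranspose_sub_le (row M) (row N)
  rw [h1 hM, h1 hN, Real.sqrt_one] at h3
  have := Real.sqrt_le_sqrt h2
  linarith

/-- A channel with Kraus operators indexed by `Λ × κ`, close to conjugation by the isometry `Z`,
becomes close to `τ ⊗ Z · ρ` when the register `Λ` is kept and the register `κ` is traced out. -/
theorem exists_isDensity_traceDist_le {G' Λ : Type} [Fintype G'] [DecidableEq G'] [Fintype Λ]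
    [Nonempty Λ] [Nonempty κ] (eHR : H ≃ R) (e : G × Λ ≃ G') (f : Λ × (G × R) ≃ G' × R)
    (hf : ∀ l g r, f (l, (g, r)) = (e (g, l), r))
    {V : Λ × κ → Matrix G H ℂ} {Z : Matrix G H ℂ} (hV : ∑ k, (V k)ᴴ * V k = 1) (hZ : Zᴴ * Z = 1)
    {ε : ℝ}
    (h : ∀ ρ : Matrix (H × R) (H × R) ℂ, IsDensity ρ → ∃ ω,
      traceDist (∑ k, conj (V k ⊗ₖ (1 : Matrix R R ℂ)) ρ) ω ≤ ε ∧
      traceDist ω (conj (Z ⊗ₖ (1 : Matrix R R ℂ)) ρ) ≤ ε)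
    {M : κ → Matrix G' H ℂ} (hM : ∀ k g l x, M k (e (g, l)) x = V (l, k) g x) :
    ∃ τ : Matrix Λ Λ ℂ, IsDensity τ ∧ ∀ ρ : Matrix (H × R) (H × R) ℂ, IsDensity ρ →
      traceDist (∑ k, conj (M k ⊗ₖ (1 : Matrix R R ℂ)) ρ)
        (relabel f (τ ⊗ₖ conj (Z ⊗ₖ (1 : Matrix R R ℂ)) ρ)) ≤ 12 * √(2 * ε) := by
  -- The state split off is the partial trace over `κ` of the pure state `φ`.
  have hdens : ∀ φ : Λ × κ → ℂ, ∑ k, ‖φ k‖ ^ 2 = 1 →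
      IsDensity ((Matrix.of fun l k => φ (l, k)) * (Matrix.of fun l k => φ (l, k))ᴴ) := by
    intro φ hφ
    apply isDensity_mul_conjTranspose
    rw [← hφ, Fintype.sum_prod_type]
    rfl
  -- On an empty input register there are no densities, and any state serves.
  rcases isEmpty_or_nonempty H with hH | hH
  · obtain ⟨φ, hφ, -⟩ := exists_unit_near (fun _ : Λ × κ => (0 : ℂ))
    refine ⟨_, hdens φ hφ, fun ρ hρ => absurd hρ.trace_eq_one ?_⟩
    simp [Matrix.trace]
  obtain ⟨φ, hφ, hclose⟩ := exists_unit_hsSq_sub_le eHR hV hZ (one_sub_le_fidelity hZ h)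
  refine ⟨_, hdens φ hφ, fun ρ hρ => ?_⟩
  -- Kraus operators of the target channel `ρ ↦ τ ⊗ Z ρ Zᴴ`.
  let N : κ → Matrix G' H ℂ := fun k =>
    Matrix.of fun p x => φ ((e.symm p).2, k) * Z (e.symm p).1 x
  have hN : ∀ k g l x, N k (e (g, l)) x = φ (l, k) * Z g x := fun k g l x => by simp [N]
  -- Moving `Λ` between the Kraus index and the output register only regroups this sum.
  have hsplit : ∀ {m : Type} [Fintype m] (F : κ → Matrix G' m ℂ) (F' : Λ × κ → Matrix G m ℂ),
      (∀ k g l x, F k (e (g, l)) x = F' (l, k) g x) →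
      ∑ k, (F k)ᴴ * F k = ∑ k, (F' k)ᴴ * F' k := by
    intro m _ F F' hF
    rw [Fintype.sum_prod_type_right]
    refine Finset.sum_congr rfl fun k _ => ?_
    ext x y
    simp only [Matrix.sum_apply, Matrix.mul_apply, Matrix.conjTranspose_apply]
    rw [← e.sum_comp, Fintype.sum_prod_type_right]
    simp only [hF]
  have hMM : ∑ k, (M k)ᴴ * M k = 1 := by rw [hsplit M V hM, hV]
  have hNN : ∑ k, (N k)ᴴ * N k = 1 := by
    rw [hsplit N (fun k => φ k • Z) hN]
    simp only [Matrix.conjTranspose_smul, Matrix.smul_mul, Matrix.mul_smul, hZ, smul_smul,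
      ← Finset.sum_smul]
    have : ∑ k, φ k * star (φ k) = 1 := by
      simp only [Complex.star_def, Complex.mul_conj']
      exact_mod_cast hφ
    rw [this, one_smul]
  have hrel : relabel f (((Matrix.of fun l k => φ (l, k)) * (Matrix.of fun l k => φ (l, k))ᴴ) ⊗ₖ
      conj (Z ⊗ₖ (1 : Matrix R R ℂ)) ρ) = ∑ k, conj (N k ⊗ₖ (1 : Matrix R R ℂ)) ρ := by
    ext p q
    obtain ⟨⟨l, g, r⟩, rfl⟩ := f.surjective p
    obtain ⟨⟨l', g', r'⟩, rfl⟩ := f.surjective q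
    simp only [Matrix.sum_apply, LinearEquiv.coe_coe, Matrix.coe_reindexLinearEquiv,
      Matrix.reindex_apply, Matrix.submatrix_apply, Equiv.symm_apply_apply]
    rw [Matrix.kroneckerMap_apply, Matrix.mul_apply, Finset.sum_mul]
    refine Finset.sum_congr rfl fun k _ => ?_
    simp only [conj_apply, Finset.mul_sum, hf, Matrix.kroneckerMap_apply, hN, Matrix.of_apply,
      Matrix.conjTranspose_apply]
    refine Finset.sum_congr rfl fun x _ => Finset.sum_congr rfl fun y _ => ?_
    simp only [star_mul']
    ring
  rw [hrel]
  have hbound : ∀ {m : Type} [Fintype m] (S : Matrix H m ℂ),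
      ∑ k, hsSq (M k * S - N k * S) ≤ 72 * ε * hsSq S := by
    intro m _ S
    have h1 : ∑ k, hsSq (M k * S - N k * S) = ∑ k, hsSq (V k * S - φ k • (Z * S)) := by
      simp only [hsSq_eq, ← Complex.re_sum, ← Matrix.trace_sum]
      rw [hsplit (fun k => M k * S - N k * S) (fun k => V k * S - φ k • (Z * S))]
      intro k g l x
      simp [Matrix.mul_apply, hM, hN, Finset.mul_sum, mul_assoc]
    rw [h1]
    exact (hclose S).trans (le_of_eq (by ring))
  refine (traceDist_sum_conj_le hMM hNN hbound hρ).trans ?_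
  -- With `δ = 4ε` the constant `18 δ` is `72 ε`, whose root `6 √(2ε)` leaves a factor two to spare.
  have : (72 * ε : ℝ) = 6 ^ 2 * (2 * ε) := by ring
  rw [this, Real.sqrt_mul (by norm_num), Real.sqrt_sq (by norm_num)]
  nlinarith [Real.sqrt_nonneg (2 * ε)]

end Rushing

/-! ### Specious adversaries -/

namespace Protocol

variable {n : ℕ} {X Y : Type} [Fintype X] [DecidableEq X] [Fintype Y] [DecidableEq Y]
  {R : Type} [Fintype R] [DecidableEq R]

/-- The isometry from the input register to the final registers that describes the ideal output. -/
def idealIso (π : Protocol n X Y) (U : Matrix.unitaryGroup (X × Y) ℂ) :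
    Matrix (π.alice.mem (Fin.last n) × π.bob.mem (Fin.last n)) (X × Y) ℂ :=
  (U : Matrix (X × Y) (X × Y) ℂ).submatrix (π.outA.prodCongr π.outB).symm id

theorem idealIso_isometry (π : Protocol n X Y) (U : Matrix.unitaryGroup (X × Y) ℂ) :
    (π.idealIso U)ᴴ * π.idealIso U = 1 := by
  rw [idealIso, Matrix.conjTranspose_submatrix, Matrix.submatrix_mul_equiv, Matrix.submatrix_id_id]
  exact Matrix.mem_unitaryGroup_iff'.mp U.2

theorem ideal_eq_conj (π : Protocol n X Y) (U : Matrix.unitaryGroup (X × Y) ℂ)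
    (ρ : Matrix ((X × Y) × R) ((X × Y) × R) ℂ) :
    π.ideal U ρ = conj (π.idealIso U ⊗ₖ (1 : Matrix R R ℂ)) ρ := by
  ext p q
  simp only [ideal, LinearEquiv.coe_coe, Matrix.coe_reindexLinearEquiv, Matrix.reindex_apply,
    Matrix.submatrix_apply, conj_apply]
  rfl

theorem traceDist_self {a : Type*} [Fintype a] [DecidableEq a] (ρ : Matrix a a ℂ) :
    traceDist ρ ρ = 0 := by
  have h := traceNorm_mul_conjTranspose_sub_le (0 : Matrix a a ℂ) 0
  have h0 := traceNorm_nonneg (0 : Matrix a a ℂ)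
  simp only [sub_self, hsSq, Matrix.zero_apply, norm_zero, ne_eq,
    OfNat.ofNat_ne_zero, not_false_eq_true, zero_pow, Finset.sum_const_zero, Real.sqrt_zero,
    zero_mul] at h
  rw [traceDist, sub_self, le_antisymm h h0, mul_zero]

theorem traceDist_nonneg {a : Type*} [Fintype a] [DecidableEq a] (ρ σ : Matrix a a ℂ) :
    0 ≤ traceDist ρ σ :=
  mul_nonneg (by norm_num) (traceNorm_nonneg _)

/-- Speciousness is needed only after the last step. For `n = 0` it says nothing, but then both
final states are relabelled inputs and can be matched exactly; `0 ≤ ε` follows from correctness on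
the given input. -/
theorem IsSpeciousA.exists_final {π : Protocol n X Y} {A' : Party n X π.orc.regA} {ε : ℝ}
    {U : Matrix.unitaryGroup (X × Y) ℂ} (hc : π.IsCorrect U R ε) (h : π.IsSpeciousA A' R ε) :
    ∃ t : SuperOp (A'.mem (Fin.last n)) (π.alice.mem (Fin.last n)), HasKraus t ∧
      ∀ ρ : Matrix ((X × Y) × R) ((X × Y) × R) ℂ, IsDensity ρ →
        traceDist ((t.onFst (π.bob.mem (Fin.last n))).onFst R (finalState π.orc A' π.bob ρ))
          (finalState π.orc π.alice π.bob ρ) ≤ ε := by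
  cases n with
  | zero =>
    refine ⟨relabel (A'.input.symm.trans π.alice.input), hasKraus_relabel _, fun ρ hρ => ?_⟩
    have : ((relabel (A'.input.symm.trans π.alice.input)).onFst (π.bob.mem (Fin.last 0))).onFst R
        (finalState π.orc A' π.bob ρ) = finalState π.orc π.alice π.bob ρ := by
      ext p q
      change ρ ((A'.input.symm (A'.input (π.alice.input.symm p.1.1)), _), _)
        ((A'.input.symm (A'.input (π.alice.input.symm q.1.1)), _), _) = _
      rw [Equiv.symm_apply_apply, Equiv.symm_apply_apply]
      rfl
    rw [this, traceDist_self]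
    exact (traceDist_nonneg _ _).trans (hc ρ hρ)
  | succ n =>
    obtain ⟨t, ht⟩ := h
    exact ⟨_, (t (Fin.last n)).hasKraus, fun ρ hρ => ht ρ hρ (Fin.last n)⟩

theorem IsSpeciousB.exists_final {π : Protocol n X Y} {B' : Party n Y π.orc.regB} {ε : ℝ}
    {U : Matrix.unitaryGroup (X × Y) ℂ} (hc : π.IsCorrect U R ε) (h : π.IsSpeciousB B' R ε) :
    ∃ t : SuperOp (B'.mem (Fin.last n)) (π.bob.mem (Fin.last n)), HasKraus t ∧
      ∀ ρ : Matrix ((X × Y) × R) ((X × Y) × R) ℂ, IsDensity ρ →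
        traceDist ((t.onSnd (π.alice.mem (Fin.last n))).onFst R (finalState π.orc π.alice B' ρ))
          (finalState π.orc π.alice π.bob ρ) ≤ ε := by
  cases n with
  | zero =>
    refine ⟨relabel (B'.input.symm.trans π.bob.input), hasKraus_relabel _, fun ρ hρ => ?_⟩
    have : ((relabel (B'.input.symm.trans π.bob.input)).onSnd (π.alice.mem (Fin.last 0))).onFst R
        (finalState π.orc π.alice B' ρ) = finalState π.orc π.alice π.bob ρ := by
      ext p q
      change ρ ((_, B'.input.symm (B'.input (π.bob.input.symm p.1.2))), _)
        ((_, B'.input.symm (B'.input (π.bob.input.symm q.1.2))), _) = _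
      rw [Equiv.symm_apply_apply, Equiv.symm_apply_apply]
      rfl
    rw [this, traceDist_self]
    exact (traceDist_nonneg _ _).trans (hc ρ hρ)
  | succ n =>
    obtain ⟨t, ht⟩ := h
    exact ⟨_, (t (Fin.last n)).hasKraus, fun ρ hρ => ht ρ hρ (Fin.last n)⟩

end Protocol

/-- Stacking Kraus operators gives a Stinespring isometry. -/
theorem isIsometry_stack {a b : Type*} [DecidableEq a] [Fintype b] {d : ℕ}
    {L : Fin d → Matrix b a ℂ} (h : ∑ i, (L i)ᴴ * L i = 1) :
    IsIsometry (Matrix.of fun (p : b × Fin d) x => L p.2 p.1 x) := by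
  rw [IsIsometry, ← h]
  ext x y
  simp only [Matrix.sum_apply, Matrix.mul_apply, Matrix.conjTranspose_apply, Matrix.of_apply,
    Fintype.sum_prod_type_right]

end Specious

namespace Specious

/-! ### Splitting off a fixed state by dilating the recovery operation -/

section Recovery

variable {H R a b a' b' : Type} [Fintype H] [DecidableEq H] [Fintype R] [DecidableEq R] [Fintype a]
  [DecidableEq a] [Fintype b] [DecidableEq b] [Fintype a'] [DecidableEq a'] [Fintype b']
  [DecidableEq b']

/-- If the operation `t` on the first party recovers, up to `ε`, states `ε`-close to `Z · ρ`, then a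
Stinespring isometry of `t` splits off a state that does not depend on the input. -/
theorem exists_isometry_of_recovery_fst (eHR : H ≃ R) {Ψ : SuperOp H (a' × b)}
    (hΨ : HasKraus Ψ) {t : SuperOp a' a} (ht : HasKraus t) {Z : Matrix (a × b) H ℂ}
    (hZ : Zᴴ * Z = 1) {ε : ℝ}
    (h : ∀ ρ : Matrix (H × R) (H × R) ℂ, IsDensity ρ → ∃ ω,
      traceDist ((t.onFst b).onFst R (Ψ.onFst R ρ)) ω ≤ ε ∧
      traceDist ω (conj (Z ⊗ₖ (1 : Matrix R R ℂ)) ρ) ≤ ε) :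
    ∃ (d : ℕ) (T : Matrix (a × Fin d) a' ℂ) (τ : Matrix (Fin d) (Fin d) ℂ),
      IsIsometry T ∧ IsDensity τ ∧ ∀ ρ : Matrix (H × R) (H × R) ℂ, IsDensity ρ →
        traceDist (conj ((T ⊗ₖ (1 : Matrix b b ℂ)) ⊗ₖ (1 : Matrix R R ℂ)) (Ψ.onFst R ρ))
          (relabel (moveToA (Fin d) a b R) (τ ⊗ₖ conj (Z ⊗ₖ (1 : Matrix R R ℂ)) ρ))
          ≤ 12 * √(2 * ε) := by
  obtain ⟨d, _, L, hL, hL1⟩ := ht.exists_fin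
  obtain ⟨κ, _, _, K, hK, hK1⟩ := hΨ
  -- The Kraus index of `t` becomes the kept register `Fin d`, while the Kraus index `κ` of `Ψ`
  -- stays the discarded environment.
  let T : Matrix (a × Fin d) a' ℂ := Matrix.of fun p x => L p.2 p.1 x
  let e : (a × b) × Fin d ≃ (a × Fin d) × b :=
    ⟨fun x => ((x.1.1, x.2), x.1.2), fun y => ((y.1.1, y.2), y.1.2), fun _ => rfl, fun _ => rfl⟩
  have hM : ∀ k g l x, ((T ⊗ₖ (1 : Matrix b b ℂ)) * K k) (e (g, l)) x
      = ((L l ⊗ₖ (1 : Matrix b b ℂ)) * K k) g x := fun k g l x => by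
    rw [Matrix.mul_apply, Matrix.mul_apply]
    refine Finset.sum_congr rfl fun y _ => ?_
    rw [Matrix.kroneckerMap_apply, Matrix.kroneckerMap_apply]
    rfl
  have hcomp := comp_eq_sum_conj (onFst_eq_sum_conj (z := b) hL) hK
  have hf : ∀ l g r, moveToA (Fin d) a b R (l, (g, r)) = (e (g, l), r) := fun _ _ _ => rfl
  have hV := sum_conjTranspose_mul_mul (sum_kronecker_one (z := b) hL1) hK1
  have hclose : ∀ ρ : Matrix (H × R) (H × R) ℂ, IsDensity ρ → ∃ ω,
      traceDist (∑ p : Fin d × κ, conj (((L p.1 ⊗ₖ (1 : Matrix b b ℂ)) * K p.2) ⊗ₖ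
        (1 : Matrix R R ℂ)) ρ) ω ≤ ε ∧
      traceDist ω (conj (Z ⊗ₖ (1 : Matrix R R ℂ)) ρ) ≤ ε := fun ρ hρ => by
    rw [← onFst_eq_sum_conj hcomp]
    exact h ρ hρ
  obtain ⟨τ, hτ, hfin⟩ := exists_isDensity_traceDist_le eHR e _ hf hV hZ hclose hM
  refine ⟨d, T, τ, isIsometry_stack hL1, hτ, fun ρ hρ => ?_⟩
  have h := hfin ρ hρ
  rw [onFst_eq_sum_conj hK, conj_sum]
  simp only [← conj_mul, ← Matrix.mul_kronecker_mul, Matrix.one_mul]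
  exact h

/-- If the operation `t` on the second party recovers, up to `ε`, states `ε`-close to `Z · ρ`, then a
Stinespring isometry of `t` splits off a state that does not depend on the input. -/
theorem exists_isometry_of_recovery_snd (eHR : H ≃ R) {Ψ : SuperOp H (a × b')}
    (hΨ : HasKraus Ψ) {t : SuperOp b' b} (ht : HasKraus t) {Z : Matrix (a × b) H ℂ}
    (hZ : Zᴴ * Z = 1) {ε : ℝ}
    (h : ∀ ρ : Matrix (H × R) (H × R) ℂ, IsDensity ρ → ∃ ω,
      traceDist ((t.onSnd a).onFst R (Ψ.onFst R ρ)) ω ≤ ε ∧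
      traceDist ω (conj (Z ⊗ₖ (1 : Matrix R R ℂ)) ρ) ≤ ε) :
    ∃ (d : ℕ) (T : Matrix (b × Fin d) b' ℂ) (τ : Matrix (Fin d) (Fin d) ℂ),
      IsIsometry T ∧ IsDensity τ ∧ ∀ ρ : Matrix (H × R) (H × R) ℂ, IsDensity ρ →
        traceDist (conj (((1 : Matrix a a ℂ) ⊗ₖ T) ⊗ₖ (1 : Matrix R R ℂ)) (Ψ.onFst R ρ))
          (relabel (moveToB (Fin d) a b R) (τ ⊗ₖ conj (Z ⊗ₖ (1 : Matrix R R ℂ)) ρ))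
          ≤ 12 * √(2 * ε) := by
  obtain ⟨d, _, L, hL, hL1⟩ := ht.exists_fin
  obtain ⟨κ, _, _, K, hK, hK1⟩ := hΨ
  let T : Matrix (b × Fin d) b' ℂ := Matrix.of fun p x => L p.2 p.1 x
  let e : (a × b) × Fin d ≃ a × (b × Fin d) := Equiv.prodAssoc _ _ _
  have hM : ∀ k g l x, (((1 : Matrix a a ℂ) ⊗ₖ T) * K k) (e (g, l)) x
      = (((1 : Matrix a a ℂ) ⊗ₖ L l) * K k) g x := fun k g l x => by
    rw [Matrix.mul_apply, Matrix.mul_apply]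
    refine Finset.sum_congr rfl fun y _ => ?_
    rw [Matrix.kroneckerMap_apply, Matrix.kroneckerMap_apply]
    rfl
  have hcomp := comp_eq_sum_conj (onSnd_eq_sum_conj (z := a) hL) hK
  have hf : ∀ l g r, moveToB (Fin d) a b R (l, (g, r)) = (e (g, l), r) := fun _ _ _ => rfl
  have hV := sum_conjTranspose_mul_mul (sum_one_kronecker (z := a) hL1) hK1
  have hclose : ∀ ρ : Matrix (H × R) (H × R) ℂ, IsDensity ρ → ∃ ω,
      traceDist (∑ p : Fin d × κ, conj ((((1 : Matrix a a ℂ) ⊗ₖ L p.1) * K p.2) ⊗ₖ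
        (1 : Matrix R R ℂ)) ρ) ω ≤ ε ∧
      traceDist ω (conj (Z ⊗ₖ (1 : Matrix R R ℂ)) ρ) ≤ ε := fun ρ hρ => by
    rw [← onFst_eq_sum_conj hcomp]
    exact h ρ hρ
  obtain ⟨τ, hτ, hfin⟩ := exists_isDensity_traceDist_le eHR e _ hf hV hZ hclose hM
  refine ⟨d, T, τ, isIsometry_stack hL1, hτ, fun ρ hρ => ?_⟩
  have h := hfin ρ hρ
  rw [onFst_eq_sum_conj hK, conj_sum]
  simp only [← conj_mul, ← Matrix.mul_kronecker_mul, Matrix.one_mul]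
  exact h

end Recovery

/-- The Rushing Lemma for an adversary in the role of Alice. -/
theorem rushing_lemma_alice (n : ℕ) (X Y R : Type) [Fintype X] [DecidableEq X] [Fintype Y]
    [DecidableEq Y] [Fintype R] [DecidableEq R] (hR : Fintype.card R = Fintype.card X * Fintype.card Y)
    (U : Matrix.unitaryGroup (X × Y) ℂ) (π : Protocol n X Y) (ε : ℝ)
    (hcorrect : π.IsCorrect U R ε) :
    ∀ A' : Party n X π.orc.regA, π.IsSpeciousA A' R ε →
    ∃ (d : ℕ)
      (T : Matrix (π.alice.mem (Fin.last n) × Fin d) (A'.mem (Fin.last n)) ℂ)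
      (τ : Matrix (Fin d) (Fin d) ℂ),
      IsIsometry T ∧ IsDensity τ ∧
      ∀ ρ : Matrix ((X × Y) × R) ((X × Y) × R) ℂ, IsDensity ρ →
        traceDist
          (conj
            ((T ⊗ₖ (1 : Matrix (π.bob.mem (Fin.last n)) (π.bob.mem (Fin.last n)) ℂ)) ⊗ₖ
              (1 : Matrix R R ℂ))
            (finalState π.orc A' π.bob ρ))
          (relabel
            (moveToA (Fin d) (π.alice.mem (Fin.last n)) (π.bob.mem (Fin.last n)) R)
            (τ ⊗ₖ π.ideal U ρ)) ≤ 12 * √(2 * ε) := by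
  classical
  intro A' hA'
  have eHR : X × Y ≃ R := Fintype.equivOfCardEq (by rw [Fintype.card_prod, hR])
  obtain ⟨t, ht, hclose⟩ := hA'.exists_final hcorrect
  obtain ⟨Ψ, hK, hΨ⟩ := exists_hasKraus_state π.orc A' π.bob (Fin.last n)
  -- The intermediate state `ω` is the honest final state: speciousness bounds one side, correctness
  -- the other.
  obtain ⟨d, T, τ, hT, hτ, h⟩ := exists_isometry_of_recovery_fst eHR hK ht
    (π.idealIso_isometry U) (ε := ε) (fun ρ hρ => ⟨finalState π.orc π.alice π.bob ρ, by
      rw [← hΨ]; exact hclose ρ hρ, by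
      rw [← Protocol.ideal_eq_conj]; exact hcorrect ρ hρ⟩)
  refine ⟨d, T, τ, hT, hτ, fun ρ hρ => ?_⟩
  rw [finalState, hΨ, Protocol.ideal_eq_conj]
  exact h ρ hρ

/-- The Rushing Lemma for an adversary in the role of Bob. -/
theorem rushing_lemma_bob (n : ℕ) (X Y R : Type) [Fintype X] [DecidableEq X] [Fintype Y]
    [DecidableEq Y] [Fintype R] [DecidableEq R] (hR : Fintype.card R = Fintype.card X * Fintype.card Y)
    (U : Matrix.unitaryGroup (X × Y) ℂ) (π : Protocol n X Y) (ε : ℝ)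
    (hcorrect : π.IsCorrect U R ε) :
    ∀ B' : Party n Y π.orc.regB, π.IsSpeciousB B' R ε →
    ∃ (d : ℕ)
      (T : Matrix (π.bob.mem (Fin.last n) × Fin d) (B'.mem (Fin.last n)) ℂ)
      (τ : Matrix (Fin d) (Fin d) ℂ),
      IsIsometry T ∧ IsDensity τ ∧
      ∀ ρ : Matrix ((X × Y) × R) ((X × Y) × R) ℂ, IsDensity ρ →
        traceDist
          (conj
            (((1 : Matrix (π.alice.mem (Fin.last n)) (π.alice.mem (Fin.last n)) ℂ) ⊗ₖ T) ⊗ₖ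
              (1 : Matrix R R ℂ))
            (finalState π.orc π.alice B' ρ))
          (relabel
            (moveToB (Fin d) (π.alice.mem (Fin.last n)) (π.bob.mem (Fin.last n)) R)
            (τ ⊗ₖ π.ideal U ρ)) ≤ 12 * √(2 * ε) := by
  classical
  intro B' hB'
  have eHR : X × Y ≃ R := Fintype.equivOfCardEq (by rw [Fintype.card_prod, hR])
  obtain ⟨t, ht, hclose⟩ := hB'.exists_final hcorrect
  obtain ⟨Ψ, hK, hΨ⟩ := exists_hasKraus_state π.orc π.alice B' (Fin.last n)
  obtain ⟨d, T, τ, hT, hτ, h⟩ := exists_isometry_of_recovery_snd eHR hK ht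
    (π.idealIso_isometry U) (ε := ε) (fun ρ hρ => ⟨finalState π.orc π.alice π.bob ρ, by
      rw [← hΨ]; exact hclose ρ hρ, by
      rw [← Protocol.ideal_eq_conj]; exact hcorrect ρ hρ⟩)
  refine ⟨d, T, τ, hT, hτ, fun ρ hρ => ?_⟩
  rw [finalState, hΨ, Protocol.ideal_eq_conj]
  exact h ρ hρ

end Specious

theorem mainTheorem3 (n : ℕ) (X Y R : Type) [Fintype X] [DecidableEq X] [Fintype Y] [DecidableEq Y]
    [Fintype R] [DecidableEq R] (hR : Fintype.card R = Fintype.card X * Fintype.card Y)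
    (U : Matrix.unitaryGroup (X × Y) ℂ) (π : Specious.Protocol n X Y) (ε : ℝ)
    (hcorrect : π.IsCorrect U R ε) :
    (∀ A' : Specious.Party n X π.orc.regA, π.IsSpeciousA A' R ε →
      ∃ (d : ℕ)
        (T : Matrix (π.alice.mem (Fin.last n) × Fin d) (A'.mem (Fin.last n)) ℂ)
        (τ : Matrix (Fin d) (Fin d) ℂ),
        Specious.IsIsometry T ∧ Specious.IsDensity τ ∧
        ∀ ρ : Matrix ((X × Y) × R) ((X × Y) × R) ℂ, Specious.IsDensity ρ →
          Specious.traceDist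
            (Specious.conj
              ((T ⊗ₖ (1 : Matrix (π.bob.mem (Fin.last n)) (π.bob.mem (Fin.last n)) ℂ)) ⊗ₖ
                (1 : Matrix R R ℂ))
              (Specious.finalState π.orc A' π.bob ρ))
            (Specious.relabel
              (Specious.moveToA (Fin d) (π.alice.mem (Fin.last n)) (π.bob.mem (Fin.last n)) R)
              (τ ⊗ₖ π.ideal U ρ)) ≤ 12 * √(2 * ε)) ∧
    (∀ B' : Specious.Party n Y π.orc.regB, π.IsSpeciousB B' R ε →
      ∃ (d : ℕ)
        (T : Matrix (π.bob.mem (Fin.last n) × Fin d) (B'.mem (Fin.last n)) ℂ)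
        (τ : Matrix (Fin d) (Fin d) ℂ),
        Specious.IsIsometry T ∧ Specious.IsDensity τ ∧
        ∀ ρ : Matrix ((X × Y) × R) ((X × Y) × R) ℂ, Specious.IsDensity ρ →
          Specious.traceDist
            (Specious.conj
              (((1 : Matrix (π.alice.mem (Fin.last n)) (π.alice.mem (Fin.last n)) ℂ) ⊗ₖ T) ⊗ₖ
                (1 : Matrix R R ℂ))
              (Specious.finalState π.orc π.alice B' ρ))
            (Specious.relabel
              (Specious.moveToB (Fin d) (π.alice.mem (Fin.last n)) (π.bob.mem (Fin.last n)) R)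
              (τ ⊗ₖ π.ideal U ρ)) ≤ 12 * √(2 * ε)) := by
  exact ⟨Specious.rushing_lemma_alice n X Y R hR U π ε hcorrect,
    Specious.rushing_lemma_bob n X Y R hR U π ε hcorrect⟩
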